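/- Let $I,J$ be disjoint index sets and $K=I\sqcup J$ ($I$ indexes left variables, $J$ right variables). A distribution is a linear functional $\varphi:\mathbb C\langle X_k\mid k\in K\rangle\to\mathbb C$ with $\varphi(1)=1$; the distribution of a family $z=(z_k)_{k\in K}$ in a non-commutative probability space $(\mathcal A,\omega)$ is $P\mapsto\omega(P(z))$. Two families $z',z''$ indexed by $K$ in $(\mathcal A,\omega)$ are *bi-free* if there are vector spaces $\mathcal X_t=\mathbb C\xi_t\oplus\mathcal X_t^\circ$ ($t\in\{{}',{}''\}$) and linear operators $S_{t,k}$ on $\mathcal X_t$ such that the joint distribution of $z',z''$ equals that of the operators $\lambda_t(S_{t,i})$ ($i\in I$) and $\rho_t(S_{t,j})$ ($j\in J$) on the free product $\mathbb C\xi\oplus\bigoplus_{n\ge1}\bigoplus_{t_1\neq\dots\neq t_n}\mathcal X_{t_1}^\circ\otimes\dots\otimes\mathcal X_{t_n}^\circ$, with respect to the functional $T\mapsto$ ($\xi$-coordinate of $T\xi$), where $\lambda_t$ and $\rho_t$ denote the action of operators on $\mathcal X_t$ on the leftmost and on the rightmost tensor factor, respectively. For a word $\alpha=\alpha(1)\cdots\alpha(n)$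 in $K$, $n\ge1$, the *bi-free cumulant* $R_\alpha$ is the unique polynomial in variables $X_\beta$ indexed by the non-empty subwords $\beta$ of $\alpha$ that has the form $R_\alpha=X_\alpha+\widetilde R_\alpha$, with $\widetilde R_\alpha$ involving only proper subwords, that is homogeneous of degree $n$ when $X_\beta$ has degree $|\beta|$, and that, evaluated at moments, satisfies $R_\alpha(z'+z'')=R_\alpha(z')+R_\alpha(z'')$ for every bi-free pair $z',z''$. A distribution $\varphi$ is a *bi-free central limit distribution* if $R_\alpha(\varphi)=0$ for all words $\alpha$ of length $1$ or $\ge3$; it is *hermitian* if moreover $\varphi(P^*P)\ge0$ for all $P\in\mathbb C\langle X_k\mid k\in K\rangle$, where $*$ is the conjugate-linear involution with $(PQ)^*=Q^*P^*$ and $X_k^*=X_k$. **Theorem 7.8.** (a) A bi-free central limit distribution $\varphi:\mathbb C\langle X_k\mid k\in I\sqcup J\rangle\to\mathbb C$ is hermitian if and only if the matrix of second order moments $C=(\varphi(X_kX_l))_{k,l\in I\sqcup J}$ is positive semidefinite. (b) Suppose that $K=I\sqcup J$ is finite, that $\mathcal H$ is a complex Hilbert space, and that $h(k)\in\mathcal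 H$ ($k\in K$) are vectors with $C=(\langle h(l),h(k)\rangle)_{k,l\in K}$, the inner product being linear in the first argument. On the full Fock space $\mathcal T(\mathcal H)=\mathbb C1\oplus\bigoplus_{n\ge1}\mathcal H^{\otimes n}$ let $l(h)\zeta=h\otimes\zeta$, $r(h)\zeta=\zeta\otimes h$, $l(h)1=r(h)1=h$, $l^*(h)=l(h)^*$, $r^*(h)=r(h)^*$, and put $x_i=l(h(i))+l^*(h(i))$ for $i\in I$ and $x_j=r(h(j))+r^*(h(j))$ for $j\in J$. Then the $x_k$ are self-adjoint, and the distribution of $(x_k)_{k\in K}$ with respect to the vacuum state $T\mapsto\langle T1,1\rangle$ is a hermitian bi-free central limit distribution with second order moment matrix $C$, and it is the only bi-free central limit distribution with second order moment matrix $C$. -/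

import Mathlib

open scoped TensorProduct DirectSum ComplexOrder ENNReal

universe u v w

noncomputable section

namespace BiFree

/-! ### Distributions of families of non-commutative random variables -/

/-- The non-commutative monomial `X_{k₁} ⋯ X_{kₙ}` in `ℂ⟨X_k | k ∈ κ⟩`. -/
def monomial {κ : Type u} (l : List κ) : FreeAlgebra ℂ κ :=
  (l.map (FreeAlgebra.ι ℂ)).prod

/-- The distribution `φ ∘ α : ℂ⟨X_k | k ∈ κ⟩ → ℂ` of a family `z` of elements of `(A, φ)`, where
`α` is the unital homomorphism with `α (X_k) = z_k`. -/
def distribution {κ : Type u} {A : Type v} [Ring A] [Algebra ℂ A] (φ : A →ₗ[ℂ] ℂ) (z : κ → A) :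
    FreeAlgebra ℂ κ →ₗ[ℂ] ℂ :=
  φ ∘ₗ (FreeAlgebra.lift ℂ z).toLinearMap

/-- The conjugate-linear involution of `ℂ⟨X_k | k ∈ κ⟩` for which every `X_k` is self-adjoint:
it reverses the monomials and conjugates the coefficients. (Mathlib's `star` on `FreeAlgebra`
is linear in the coefficients, so it is not the involution needed here.) -/
def adj {κ : Type u} (P : FreeAlgebra ℂ κ) : FreeAlgebra ℂ κ :=
  Finsupp.sum (FreeAlgebra.equivMonoidAlgebraFreeMonoid (R := ℂ) P).coeff
    fun m c => (starRingEnd ℂ c) • monomial (FreeMonoid.toList m).reverse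

/-! ### Vector spaces with a specified state-vector and their free products -/

/-- A vector space with specified state-vector, given as a triple `(X, ψ, ξ)` with `ψ ξ = 1`;
the distinguished subspace of codimension one is the kernel of `ψ`. -/
structure StateVectorSpace where
  carrier : Type u
  [addCommGroup : AddCommGroup carrier]
  [module : Module ℂ carrier]
  ψ : carrier →ₗ[ℂ] ℂ
  ξ : carrier
  ψ_ξ : ψ ξ = 1

attribute [instance] StateVectorSpace.addCommGroup StateVectorSpace.module

namespace StateVectorSpace

instance : CoeSort StateVectorSpace.{u} (Type u) := ⟨StateVectorSpace.carrier⟩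

/-- The subspace `X° = ker ψ`. -/
abbrev centered (X : StateVectorSpace.{u}) : Submodule ℂ X := LinearMap.ker X.ψ

/-- The projection `x ↦ x - ψ(x) ξ` of `X` onto `X°` along `ξ`. -/
def center (X : StateVectorSpace.{u}) : X →ₗ[ℂ] X.centered :=
  (LinearMap.id - X.ψ.smulRight X.ξ).codRestrict X.centered
    (fun x => by simp [X.ψ_ξ])

/-- The functional `T ↦ ψ (T ξ)` on the algebra of linear operators on `X`. -/
def expectation (X : StateVectorSpace.{u}) : Module.End ℂ X →ₗ[ℂ] ℂ :=
  X.ψ ∘ₗ LinearMap.applyₗ X.ξ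

end StateVectorSpace

section TensorAlgebra

variable {M : Type u} [AddCommGroup M] [Module ℂ M]

variable (M) in
/-- `m ↦ ((η, ζ) ↦ (m ⊗ η, m ⊗ η))`. -/
def peelLeftStep : M →ₗ[ℂ] Module.End ℂ (TensorAlgebra ℂ M × (M ⊗[ℂ] TensorAlgebra ℂ M)) :=
  LinearMap.mk₂ ℂ
    (fun m p => (TensorAlgebra.ι ℂ m * p.1, m ⊗ₜ[ℂ] p.1))
    (fun m m' p => by simp [add_mul, TensorProduct.add_tmul])
    (fun c m p => by simp [TensorProduct.smul_tmul'])
    (fun m p q => by simp [mul_add, TensorProduct.tmul_add])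
    (fun c m p => by simp)

theorem peelLeftStep_apply (m : M) (p : TensorAlgebra ℂ M × (M ⊗[ℂ] TensorAlgebra ℂ M)) :
    peelLeftStep M m p = (TensorAlgebra.ι ℂ m * p.1, m ⊗ₜ[ℂ] p.1) := rfl

/-- The linear map `T(M) → M ⊗ T(M)` with `1 ↦ 0` and `m ⊗ η ↦ m ⊗ η`. -/
def peelLeft : TensorAlgebra ℂ M →ₗ[ℂ] M ⊗[ℂ] TensorAlgebra ℂ M :=
  LinearMap.snd ℂ (TensorAlgebra ℂ M) (M ⊗[ℂ] TensorAlgebra ℂ M) ∘ₗ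
    LinearMap.applyₗ ((1 : TensorAlgebra ℂ M), (0 : M ⊗[ℂ] TensorAlgebra ℂ M)) ∘ₗ
    (TensorAlgebra.lift ℂ (peelLeftStep M)).toLinearMap

variable (M) in
/-- `m ↦ ((η, ζ) ↦ (η ⊗ m, η ⊗ m))`, with values in the opposite algebra. -/
def peelRightStep :
    M →ₗ[ℂ] (Module.End ℂ (TensorAlgebra ℂ M × (TensorAlgebra ℂ M ⊗[ℂ] M)))ᵐᵒᵖ :=
  (MulOpposite.opLinearEquiv ℂ).toLinearMap ∘ₗ LinearMap.mk₂ ℂ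
    (fun m p => (p.1 * TensorAlgebra.ι ℂ m, p.1 ⊗ₜ[ℂ] m))
    (fun m m' p => by simp [mul_add, TensorProduct.tmul_add])
    (fun c m p => by simp)
    (fun m p q => by simp [add_mul, TensorProduct.add_tmul])
    (fun c m p => by simp [TensorProduct.smul_tmul'])

theorem peelRightStep_apply (m : M) (p : TensorAlgebra ℂ M × (TensorAlgebra ℂ M ⊗[ℂ] M)) :
    (peelRightStep M m).unop p = (p.1 * TensorAlgebra.ι ℂ m, p.1 ⊗ₜ[ℂ] m) := rfl

/-- The linear map `T(M) → T(M) ⊗ M` with `1 ↦ 0` and `η ⊗ m ↦ η ⊗ m`. -/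
def peelRight : TensorAlgebra ℂ M →ₗ[ℂ] TensorAlgebra ℂ M ⊗[ℂ] M :=
  LinearMap.snd ℂ (TensorAlgebra ℂ M) (TensorAlgebra ℂ M ⊗[ℂ] M) ∘ₗ
    LinearMap.applyₗ ((1 : TensorAlgebra ℂ M), (0 : TensorAlgebra ℂ M ⊗[ℂ] M)) ∘ₗ
    (MulOpposite.opLinearEquiv ℂ).symm.toLinearMap ∘ₗ
    (TensorAlgebra.lift ℂ (peelRightStep M)).toLinearMap

theorem peelLeft_one : peelLeft (1 : TensorAlgebra ℂ M) = 0 := by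
  simp [peelLeft]

theorem peelRight_one : peelRight (1 : TensorAlgebra ℂ M) = 0 := by
  simp [peelRight]

theorem peelLeft_ι_mul (m : M) (η : TensorAlgebra ℂ M) :
    peelLeft (TensorAlgebra.ι ℂ m * η) = m ⊗ₜ[ℂ] η := by
  have key : ∀ (η : TensorAlgebra ℂ M) (p : TensorAlgebra ℂ M × (M ⊗[ℂ] TensorAlgebra ℂ M)),
      (TensorAlgebra.lift ℂ
        (A := Module.End ℂ (TensorAlgebra ℂ M × (M ⊗[ℂ] TensorAlgebra ℂ M))) (peelLeftStep M) η
          p).1 = η * p.1 := by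
    intro η
    induction η using TensorAlgebra.induction with
    | algebraMap r => intro p; simp [Algebra.smul_def]
    | ι x => intro p; simp [peelLeftStep_apply]
    | mul a b ha hb => intro p; simp [ha, hb, mul_assoc]
    | add a b ha hb => intro p; simp [ha, hb, add_mul]
  simp only [peelLeft, LinearMap.comp_apply, LinearMap.applyₗ_apply_apply, AlgHom.toLinearMap_apply,
    map_mul, TensorAlgebra.lift_ι_apply, Module.End.mul_apply, LinearMap.snd_apply]
  simp [peelLeftStep_apply, key]

theorem peelRight_mul_ι (m : M) (η : TensorAlgebra ℂ M) :
    peelRight (η * TensorAlgebra.ι ℂ m) = η ⊗ₜ[ℂ] m := by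
  have key : ∀ (η : TensorAlgebra ℂ M) (p : TensorAlgebra ℂ M × (TensorAlgebra ℂ M ⊗[ℂ] M)),
      ((TensorAlgebra.lift ℂ
        (A := (Module.End ℂ (TensorAlgebra ℂ M × (TensorAlgebra ℂ M ⊗[ℂ] M)))ᵐᵒᵖ)
          (peelRightStep M) η).unop p).1 = p.1 * η := by
    intro η
    induction η using TensorAlgebra.induction with
    | algebraMap r => intro p; simp [Algebra.smul_def, Algebra.commutes]
    | ι x => intro p; simp [peelRightStep_apply]
    | mul a b ha hb => intro p; simp [ha, hb, mul_assoc]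
    | add a b ha hb => intro p; simp [ha, hb, mul_add]
  simp only [peelRight, LinearMap.comp_apply, LinearMap.applyₗ_apply_apply,
    AlgHom.toLinearMap_apply, map_mul, TensorAlgebra.lift_ι_apply, LinearMap.snd_apply,
    LinearEquiv.coe_coe, MulOpposite.coe_opLinearEquiv_symm, MulOpposite.unop_mul,
    Module.End.mul_apply]
  simp [peelRightStep_apply, key]

end TensorAlgebra

section FreeProduct

variable {T : Type} [DecidableEq T] (X : T → StateVectorSpace.{u})

/-- The tensor algebra of `⨁ₜ X_t°`, that is, the direct sum of `X_{t₁}° ⊗ ⋯ ⊗ X_{tₙ}°` over all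
words `t₁ ⋯ tₙ`. The free product is the subspace formed by the words with `t₁ ≠ t₂ ≠ ⋯ ≠ tₙ`. -/
abbrev Ambient : Type u := TensorAlgebra ℂ (⨁ t, (X t).centered)

/-- The inclusion of `X_t°`. -/
def letter (t : T) : (X t).centered →ₗ[ℂ] Ambient X :=
  TensorAlgebra.ι ℂ ∘ₗ DirectSum.lof ℂ T (fun t => (X t).centered) t

/-- The inclusion of `X_t = ℂξ_t ⊕ X_t°`, with `ξ_t` identified with `1`. -/
def incl (t : T) : X t →ₗ[ℂ] Ambient X :=
  Algebra.linearMap ℂ (Ambient X) ∘ₗ (X t).ψ + letter X t ∘ₗ (X t).center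

/-- The elementary tensor `x₁ ⊗ ⋯ ⊗ xₙ`. -/
def tensorWord (l : List (Σ t, (X t).centered)) : Ambient X :=
  (l.map fun p => letter X p.1 p.2).prod

/-- The elementary tensors `x₁ ⊗ ⋯ ⊗ xₙ`, `x_j ∈ X_{t_j}°`, with `t₁ ≠ t₂ ≠ ⋯ ≠ tₙ`. -/
def IsAlternating (l : List (Σ t, (X t).centered)) : Prop :=
  l.IsChain fun p q => p.1 ≠ q.1

/-- The space `ℂξ ⊕ ⨁_{n ≥ 1} ⨁_{t₁ ≠ ⋯ ≠ tₙ} X_{t₁}° ⊗ ⋯ ⊗ X_{tₙ}°`. -/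
def freeProductSpace : Submodule ℂ (Ambient X) :=
  Submodule.span ℂ (tensorWord X '' {l | IsAlternating X l})

/-- The left action of an operator `S` on `X_t`, on all words:
`1 ↦ Sξ_t`, `x ⊗ η ↦ (S x) ⊗ η` for `x ∈ X_t°`, and `x ⊗ η ↦ (S ξ_t) ⊗ x ⊗ η` for `x ∈ X_s°`,
`s ≠ t`, where `X_t = ℂξ_t ⊕ X_t°` and `ξ_t ⊗ η = η`. -/
def ambientLeft (t : T) (S : Module.End ℂ (X t)) : Module.End ℂ (Ambient X) :=
  (TensorAlgebra.algebraMapInv (R := ℂ) (M := ⨁ t, (X t).centered)).toLinearMap.smulRight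
      (incl X t (S (X t).ξ)) +
    TensorProduct.lift (DirectSum.toModule ℂ T _ (Function.update
      (fun s => LinearMap.mul ℂ (Ambient X) ∘ₗ
        LinearMap.mulLeft ℂ (incl X t (S (X t).ξ)) ∘ₗ letter X s)
      t (LinearMap.mul ℂ (Ambient X) ∘ₗ incl X t ∘ₗ S ∘ₗ (X t).centered.subtype))) ∘ₗ peelLeft

/-- The right action of an operator `S` on `X_t`, on all words:
`1 ↦ Sξ_t`, `η ⊗ x ↦ η ⊗ (S x)` for `x ∈ X_t°`, and `η ⊗ x ↦ η ⊗ x ⊗ (S ξ_t)` for `x ∈ X_s°`,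
`s ≠ t`, where `X_t = ℂξ_t ⊕ X_t°` and `η ⊗ ξ_t = η`. -/
def ambientRight (t : T) (S : Module.End ℂ (X t)) : Module.End ℂ (Ambient X) :=
  (TensorAlgebra.algebraMapInv (R := ℂ) (M := ⨁ t, (X t).centered)).toLinearMap.smulRight
      (incl X t (S (X t).ξ)) +
    TensorProduct.lift (DirectSum.toModule ℂ T _ (Function.update
      (fun s => (LinearMap.mul ℂ (Ambient X)).flip ∘ₗ
        LinearMap.mulRight ℂ (incl X t (S (X t).ξ)) ∘ₗ letter X s)
      t ((LinearMap.mul ℂ (Ambient X)).flip ∘ₗ incl X t ∘ₗ S ∘ₗ (X t).centered.subtype))).flip ∘ₗ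
      peelRight

theorem ambientLeft_one (t : T) (S : Module.End ℂ (X t)) :
    ambientLeft X t S 1 = incl X t (S (X t).ξ) := by
  simp [ambientLeft, peelLeft_one]

theorem ambientLeft_same (t : T) (S : Module.End ℂ (X t)) (x : (X t).centered) (η : Ambient X) :
    ambientLeft X t S (letter X t x * η) = incl X t (S x) * η := by
  simp [ambientLeft, letter, peelLeft_ι_mul, TensorAlgebra.algebraMapInv]

theorem ambientLeft_ne {s t : T} (h : s ≠ t) (S : Module.End ℂ (X t)) (x : (X s).centered)
    (η : Ambient X) :
    ambientLeft X t S (letter X s x * η) = incl X t (S (X t).ξ) * (letter X s x * η) := by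
  simp [ambientLeft, letter, peelLeft_ι_mul, TensorAlgebra.algebraMapInv, h, mul_assoc]

theorem ambientRight_one (t : T) (S : Module.End ℂ (X t)) :
    ambientRight X t S 1 = incl X t (S (X t).ξ) := by
  simp [ambientRight, peelRight_one]

theorem ambientRight_same (t : T) (S : Module.End ℂ (X t)) (x : (X t).centered) (η : Ambient X) :
    ambientRight X t S (η * letter X t x) = η * incl X t (S x) := by
  simp [ambientRight, letter, peelRight_mul_ι, TensorAlgebra.algebraMapInv]

theorem ambientRight_ne {s t : T} (h : s ≠ t) (S : Module.End ℂ (X t)) (x : (X s).centered)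
    (η : Ambient X) :
    ambientRight X t S (η * letter X s x) = η * letter X s x * incl X t (S (X t).ξ) := by
  simp [ambientRight, letter, peelRight_mul_ι, TensorAlgebra.algebraMapInv, h, mul_assoc]

theorem tensorWord_mem {l : List (Σ t, (X t).centered)} (h : IsAlternating X l) :
    tensorWord X l ∈ freeProductSpace X :=
  Submodule.subset_span ⟨l, h, rfl⟩

theorem incl_mul_mem (t : T) (y : X t) {l : List (Σ t, (X t).centered)} (h : IsAlternating X l)
    (ht : ∀ p ∈ l.head?, t ≠ p.1) : incl X t y * tensorWord X l ∈ freeProductSpace X := by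
  have h2 : letter X t ((X t).center y) * tensorWord X l
      = tensorWord X (⟨t, (X t).center y⟩ :: l) := by simp [tensorWord]
  have h3 : IsAlternating X (⟨t, (X t).center y⟩ :: l) := by
    cases l with
    | nil => simp [IsAlternating]
    | cons p l => exact List.isChain_cons_cons.2 ⟨ht p (by simp), h⟩
  simp only [incl, LinearMap.add_apply, LinearMap.comp_apply, add_mul, h2,
    Algebra.linearMap_apply, ← Algebra.smul_def]
  exact add_mem (Submodule.smul_mem _ _ (tensorWord_mem X h)) (tensorWord_mem X h3)

theorem mul_incl_mem (t : T) (y : X t) {l : List (Σ t, (X t).centered)} (h : IsAlternating X l)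
    (ht : ∀ p ∈ l.getLast?, p.1 ≠ t) : tensorWord X l * incl X t y ∈ freeProductSpace X := by
  have h2 : tensorWord X l * letter X t ((X t).center y)
      = tensorWord X (l ++ [⟨t, (X t).center y⟩]) := by simp [tensorWord]
  have h3 : IsAlternating X (l ++ [⟨t, (X t).center y⟩]) :=
    List.isChain_append.2 ⟨h, by simp, fun p hp q hq => by
      simp only [List.head?_cons, Option.mem_some_iff] at hq
      subst hq; exact ht p hp⟩
  simp only [incl, LinearMap.add_apply, LinearMap.comp_apply, mul_add, h2,
    Algebra.linearMap_apply, ← Algebra.commutes, ← Algebra.smul_def]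
  exact add_mem (Submodule.smul_mem _ _ (tensorWord_mem X h)) (tensorWord_mem X h3)

theorem ambientLeft_mem (t : T) (S : Module.End ℂ (X t)) :
    ∀ η ∈ freeProductSpace X, ambientLeft X t S η ∈ freeProductSpace X := by
  intro η hη
  refine Submodule.span_induction (p := fun η _ => ambientLeft X t S η ∈ freeProductSpace X)
    ?_ (by simp) (fun a b _ _ ha hb => by simpa using add_mem ha hb)
    (fun c a _ ha => by simpa using Submodule.smul_mem _ c ha) hη
  rintro _ ⟨l, hl, rfl⟩
  rcases l with _ | ⟨⟨s, x⟩, l⟩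
  · have := incl_mul_mem X t (S (X t).ξ) (l := []) hl (by simp)
    simpa [tensorWord, ambientLeft_one] using this
  · have e : tensorWord X (⟨s, x⟩ :: l) = letter X s x * tensorWord X l := by simp [tensorWord]
    by_cases h : s = t
    · subst h
      rw [e, ambientLeft_same]
      refine incl_mul_mem X s _ (List.IsChain.tail hl) ?_
      cases l with
      | nil => simp
      | cons p l => simpa using (List.isChain_cons_cons.1 hl).1
    · rw [e, ambientLeft_ne X h, ← e]
      exact incl_mul_mem X t _ hl (by simpa using Ne.symm h)

theorem ambientRight_mem (t : T) (S : Module.End ℂ (X t)) :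
    ∀ η ∈ freeProductSpace X, ambientRight X t S η ∈ freeProductSpace X := by
  intro η hη
  refine Submodule.span_induction (p := fun η _ => ambientRight X t S η ∈ freeProductSpace X)
    ?_ (by simp) (fun a b _ _ ha hb => by simpa using add_mem ha hb)
    (fun c a _ ha => by simpa using Submodule.smul_mem _ c ha) hη
  rintro _ ⟨l, hl, rfl⟩
  rcases List.eq_nil_or_concat l with rfl | ⟨l, ⟨s, x⟩, rfl⟩
  · have := mul_incl_mem X t (S (X t).ξ) (l := []) hl (by simp)
    simpa [tensorWord, ambientRight_one] using this
  · rw [List.concat_eq_append] at hl ⊢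
    have e : tensorWord X (l ++ [⟨s, x⟩]) = tensorWord X l * letter X s x := by simp [tensorWord]
    have hl' := List.isChain_append.1 hl
    by_cases h : s = t
    · subst h
      rw [e, ambientRight_same]
      exact mul_incl_mem X s _ hl'.1 (fun p hp => hl'.2.2 p hp ⟨s, x⟩ (by simp))
    · rw [e, ambientRight_ne X h, ← e]
      exact mul_incl_mem X t _ hl (by simpa using h)

/-- The free product `(X, X°, ξ)` of the vector spaces with specified state-vector `X_t`. -/
def freeProduct : StateVectorSpace.{u} where
  carrier := freeProductSpace X
  ψ := (TensorAlgebra.algebraMapInv (R := ℂ) (M := ⨁ t, (X t).centered)).toLinearMap ∘ₗ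
    (freeProductSpace X).subtype
  ξ := ⟨1, Submodule.subset_span ⟨[], by simp [IsAlternating], by simp [tensorWord]⟩⟩
  ψ_ξ := by simp

/-- The left operator `λ_t(S)` on the free product. -/
def leftOp (t : T) (S : Module.End ℂ (X t)) : Module.End ℂ (freeProduct X) :=
  (ambientLeft X t S).restrict (ambientLeft_mem X t S)

/-- The right operator `ρ_t(S)` on the free product. -/
def rightOp (t : T) (S : Module.End ℂ (X t)) : Module.End ℂ (freeProduct X) :=
  (ambientRight X t S).restrict (ambientRight_mem X t S)

end FreeProduct

/-! ### Bi-freeness and bi-free cumulants -/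

/-- The two-faced families `z_t = ((z_{t,i})_{i ∈ I}, (z_{t,j})_{j ∈ J})`, `t ∈ T`, are bi-free in
`(A, φ)`: there are vector spaces with specified state-vector `X_t` and unital homomorphisms
`ℂ⟨X_i | i ∈ I⟩ → L(X_t)` and `ℂ⟨X_j | j ∈ J⟩ → L(X_t)`, given by the images `S_{t,k}` of the
generators, such that the joint distribution of the `z_{t,k}` equals that of the family
`λ_t(S_{t,i})`, `ρ_t(S_{t,j})` of operators on the free product of the `X_t`. -/
def IsBiFree {I J : Type u} {T : Type} [DecidableEq T] {A : Type v} [Ring A] [Algebra ℂ A]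
    (φ : A →ₗ[ℂ] ℂ) (z : T → I ⊕ J → A) : Prop :=
  ∃ (X : T → StateVectorSpace.{u}) (S : ∀ t, I ⊕ J → Module.End ℂ (X t)),
    distribution φ (fun p : T × (I ⊕ J) => z p.1 p.2) =
      distribution (freeProduct X).expectation (fun p : T × (I ⊕ J) =>
        Sum.elim (fun i => leftOp X p.1 (S p.1 (Sum.inl i)))
          (fun j => rightOp X p.1 (S p.1 (Sum.inr j))) p.2)

/-- The value of a polynomial `R` in commuting variables `X_v`, indexed by words `v`, at the
moments `X_v = μ(X_{v₁} ⋯ X_{vₖ})`. -/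
def evalMoments {κ : Type u} (μ : FreeAlgebra ℂ κ →ₗ[ℂ] ℂ) (R : MvPolynomial (List κ) ℂ) : ℂ :=
  MvPolynomial.eval (fun v => μ (monomial v)) R

/-- `R` is the bi-free cumulant polynomial `R_α` of the word `α = α(1) ⋯ α(n)`, `n ≥ 1`. The
variables `X_{αK}` of `R_α` are indexed by the non-empty subwords `αK` of `α`. -/
structure IsBiFreeCumulantPolynomial {I J : Type u} (α : List (I ⊕ J))
    (R : MvPolynomial (List (I ⊕ J)) ℂ) : Prop where
  /-- `R_α = X_α + R̃_α`, where `R̃_α` involves only the variables of proper non-empty subwords. -/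
  leading : ∀ v ∈ (R - MvPolynomial.X α).vars, v ≠ [] ∧ v ≠ α ∧ v.Sublist α
  /-- `R_α` is homogeneous of degree `n` when `X_v` is given the degree `|v|`. -/
  homogeneous : R.IsWeightedHomogeneous List.length α.length
  /-- `R_α` is additive on bi-free pairs of two-faced families. -/
  additive : ∀ (A : Type u) [Ring A] [Algebra ℂ A] (φ : A →ₗ[ℂ] ℂ), φ 1 = 1 →
    ∀ z' z'' : I ⊕ J → A, IsBiFree φ (fun b : Bool => cond b z'' z') →
      evalMoments (distribution φ z') R + evalMoments (distribution φ z'') R =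
        evalMoments (distribution φ (z' + z'')) R

/-- The bi-free cumulant `R_α(μ)` of the distribution `μ` vanishes. -/
def CumulantVanishes {I J : Type u} (μ : FreeAlgebra ℂ (I ⊕ J) →ₗ[ℂ] ℂ) (α : List (I ⊕ J)) :
    Prop :=
  ∃ R, IsBiFreeCumulantPolynomial α R ∧ evalMoments μ R = 0

/-- `μ : ℂ⟨X_k | k ∈ I ∐ J⟩ → ℂ` is a bi-free central limit distribution (with left indices `I`
and right indices `J`): a distribution whose bi-free cumulants of order `1` and of order `≥ 3`
vanish. -/
structure IsBiFreeCentralLimit {I J : Type u} (μ : FreeAlgebra ℂ (I ⊕ J) →ₗ[ℂ] ℂ) : Prop where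
  map_one : μ 1 = 1
  cumulant : ∀ α : List (I ⊕ J), α.length = 1 ∨ 3 ≤ α.length → CumulantVanishes μ α

/-- `μ` is a hermitian bi-free central limit distribution: `μ(P*P) ≥ 0` for all `P`, for the
`*`-algebra structure with `X_k = X_k*`. -/
structure IsHermitianBiFreeCentralLimit {I J : Type u} (μ : FreeAlgebra ℂ (I ⊕ J) →ₗ[ℂ] ℂ) :
    Prop extends IsBiFreeCentralLimit μ where
  nonneg : ∀ P : FreeAlgebra ℂ (I ⊕ J), 0 ≤ μ (adj P * P)

/-- The matrix of second order moments `C_{kl} = μ(X_k X_l)`. -/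
def secondMoments {κ : Type u} (μ : FreeAlgebra ℂ κ →ₗ[ℂ] ℂ) : Matrix κ κ ℂ :=
  Matrix.of fun k l => μ (FreeAlgebra.ι ℂ k * FreeAlgebra.ι ℂ l)

/-! ### The full Fock space -/

/-- A bundled complex inner product space. -/
structure PreHilbert where
  carrier : Type w
  [normed : NormedAddCommGroup carrier]
  [inner : InnerProductSpace ℂ carrier]

attribute [instance] PreHilbert.normed PreHilbert.inner

section Fock

variable (H : Type w) [NormedAddCommGroup H] [InnerProductSpace ℂ H]

/-- The algebraic tensor powers of `H` with their inner products: a copy of `ℂ` for `n = 0`, and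
`H^{⊗(n+1)} = H ⊗ H^{⊗n}`. -/
def tensorPower : ℕ → PreHilbert.{w}
  | 0 => ⟨EuclideanSpace ℂ PUnit.{w + 1}⟩
  | n + 1 => ⟨H ⊗[ℂ] (tensorPower n).carrier⟩

/-- The space `H^{⊗n}`. -/
abbrev Level (n : ℕ) : Type w := (tensorPower H n).carrier

variable {H}

/-- `ζ ↦ h ⊗ ζ`, as a map `H^{⊗n} → H^{⊗(n+1)}`. -/
def tensorLeft (h : H) (n : ℕ) : Level H n →ₗ[ℂ] Level H (n + 1) :=
  TensorProduct.mk ℂ H (Level H n) h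

/-- `ζ ↦ ζ ⊗ h`, as a map `H^{⊗n} → H^{⊗(n+1)}`. -/
def tensorRight (h : H) : ∀ n : ℕ, Level H n →ₗ[ℂ] Level H (n + 1)
  | 0 => tensorLeft h 0
  | n + 1 => LinearMap.lTensor H (tensorRight h n)

theorem inner_tensorLeft (h h' : H) (n : ℕ) (x y : Level H n) :
    inner ℂ (tensorLeft h n x) (tensorLeft h' n y) = inner ℂ h h' * inner ℂ x y :=
  TensorProduct.inner_tmul (𝕜 := ℂ) (E := H) (F := Level H n) h h' x y

theorem inner_lTensor {E F : Type w} [NormedAddCommGroup E] [InnerProductSpace ℂ E]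
    [NormedAddCommGroup F] [InnerProductSpace ℂ F] (S : E →ₗ[ℂ] F) (c : ℂ)
    (hS : ∀ x y, inner ℂ (S x) (S y) = c * inner ℂ x y) (x y : H ⊗[ℂ] E) :
    inner ℂ (LinearMap.lTensor H S x) (LinearMap.lTensor H S y) = c * inner ℂ x y := by
  induction x using TensorProduct.induction_on with
  | zero => simp
  | add a b ha hb => simp only [map_add, inner_add_left, ha, hb, mul_add]
  | tmul a b =>
    induction y using TensorProduct.induction_on with
    | zero => simp
    | add a b ha hb => simp only [map_add, inner_add_right, ha, hb, mul_add]
    | tmul d e =>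
      simp only [LinearMap.lTensor_tmul, TensorProduct.inner_tmul, hS]
      ring

theorem inner_tensorRight (h : H) (n : ℕ) (x y : Level H n) :
    inner ℂ (tensorRight h n x) (tensorRight h n y) = inner ℂ h h * inner ℂ x y := by
  induction n with
  | zero => exact inner_tensorLeft h h 0 x y
  | succ n ih => exact inner_lTensor (tensorRight h n) (inner ℂ h h) ih x y

theorem norm_eq_of_inner {E F : Type w} [NormedAddCommGroup E] [InnerProductSpace ℂ E]
    [NormedAddCommGroup F] [InnerProductSpace ℂ F] (h : H) (x : E) (y : F)
    (hxy : inner ℂ y y = inner ℂ h h * inner ℂ x x) : ‖y‖ = ‖h‖ * ‖x‖ := by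
  simp only [inner_self_eq_norm_sq_to_K] at hxy
  have h2 : ‖y‖ ^ 2 = (‖h‖ * ‖x‖) ^ 2 := by rw [mul_pow]; exact_mod_cast hxy
  exact (pow_left_inj₀ (norm_nonneg _) (by positivity) two_ne_zero).1 h2

variable (H) in
/-- The inner product space of square-summable sequences of elements of `H^{⊗n}`, `n ≥ 0`. -/
abbrev PreFock : Type w := lp (fun n => Level H n) 2

variable (H) in
/-- The full Fock space `ℂ1 ⊕ ⨁_{n ≥ 1} H^{⊗n}` (Hilbert space tensor products and direct sum). -/
abbrev FullFock : Type w := UniformSpace.Completion (PreFock H)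

variable (H) in
/-- The unit `1` of `H^{⊗0} = ℂ`. -/
def tensorUnit : Level H 0 :=
  (EuclideanSpace.single PUnit.unit (1 : ℂ) : EuclideanSpace ℂ PUnit.{w + 1})

theorem inner_tensorUnit : inner ℂ (tensorUnit H) (tensorUnit H) = 1 := by
  change inner ℂ (EuclideanSpace.single PUnit.unit (1 : ℂ) : EuclideanSpace ℂ PUnit.{w + 1})
    (EuclideanSpace.single PUnit.unit (1 : ℂ)) = 1
  simp

variable (H) in
/-- The vacuum vector `1`. -/
def vacuum : FullFock H := ((lp.single 2 0 (tensorUnit H) : PreFock H) : FullFock H)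

/-- The underlying sequence of `raise`. -/
def raiseFun (S : ∀ n, Level H n →ₗ[ℂ] Level H (n + 1)) (f : ∀ n, Level H n) : ∀ n, Level H n
  | 0 => 0
  | n + 1 => S n (f n)

theorem hasSum_raiseFun (S : ∀ n, Level H n →ₗ[ℂ] Level H (n + 1)) (c : ℝ)
    (hS : ∀ n x, ‖S n x‖ = c * ‖x‖) (f : PreFock H) :
    HasSum (fun n => ‖raiseFun S f n‖ ^ (2 : ℝ≥0∞).toReal)
      (c ^ 2 * ‖f‖ ^ (2 : ℝ≥0∞).toReal) := by
  have h1 := (lp.hasSum_norm (p := 2) (by simp) f).mul_left (c ^ 2)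
  rw [← hasSum_nat_add_iff' 1]
  simpa [raiseFun, hS, mul_pow] using h1

/-- The operator on sequences given by maps `S n : H^{⊗n} → H^{⊗(n+1)}` with `‖S n x‖ = c ‖x‖`. -/
def raise (S : ∀ n, Level H n →ₗ[ℂ] Level H (n + 1)) (c : ℝ)
    (hS : ∀ n x, ‖S n x‖ = c * ‖x‖) : PreFock H →L[ℂ] PreFock H :=
  LinearMap.mkContinuous
    { toFun := fun f => ⟨raiseFun S f, memℓp_gen (hasSum_raiseFun S c hS f).summable⟩
      map_add' := fun f g => by
        ext n
        cases n with
        | zero => exact (add_zero _).symm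
        | succ n => exact map_add (S n) (f n) (g n)
      map_smul' := fun a f => by
        ext n
        cases n with
        | zero => exact (smul_zero a).symm
        | succ n => exact map_smul (S n) a (f n) }
    |c| (fun f => by
      have h1 := (lp.hasSum_norm (p := 2) (by simp)
        (⟨raiseFun S f, memℓp_gen (hasSum_raiseFun S c hS f).summable⟩ : PreFock H)).unique
        (hasSum_raiseFun S c hS f)
      refine abs_le_of_sq_le_sq' ?_ (by positivity) |>.2
      rw [mul_pow, sq_abs]
      exact_mod_cast h1.le)

/-- `l(h) ζ = h ⊗ ζ`. -/
def leftCreation (h : H) : FullFock H →L[ℂ] FullFock H :=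
  (raise (tensorLeft h) ‖h‖ fun n x =>
    norm_eq_of_inner h x _ (inner_tensorLeft h h n x x)).completion

/-- `r(h) ζ = ζ ⊗ h`. -/
def rightCreation (h : H) : FullFock H →L[ℂ] FullFock H :=
  (raise (tensorRight h) ‖h‖ fun n x =>
    norm_eq_of_inner h x _ (inner_tensorRight h n x x)).completion

variable (H) in
/-- The vacuum expectation `T ↦ ⟨T1, 1⟩` (Mathlib's inner product is linear in its second
argument). -/
def vacuumState : (FullFock H →L[ℂ] FullFock H) →ₗ[ℂ] ℂ where
  toFun S := inner ℂ (vacuum H) (S (vacuum H))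
  map_add' S S' := by simp [inner_add_right]
  map_smul' c S := by simp [inner_smul_right]

/-- The two-faced family `x_i = l(h(i)) + l*(h(i))`, `i ∈ I`, and `x_j = r(h(j)) + r*(h(j))`,
`j ∈ J`, on the full Fock space. -/
def fockFamily {I J : Type u} (h : I ⊕ J → H) : I ⊕ J → (FullFock H →L[ℂ] FullFock H) :=
  Sum.elim
    (fun i => leftCreation (h (Sum.inl i)) +
      ContinuousLinearMap.adjoint (leftCreation (h (Sum.inl i))))
    (fun j => rightCreation (h (Sum.inr j)) +
      ContinuousLinearMap.adjoint (rightCreation (h (Sum.inr j))))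

end Fock
end BiFree

end

noncomputable section

namespace BiFree

/-! ### Linear functionals on the free algebra -/

/-! Everything is measured against one explicit model. For any prescribed numbers `κ α` there is a
distribution `cumDist κ` with these bi-free cumulants. Its variables act on the tensor algebra over
the space spanned by words. At its own end of a tensor word, the variable `k` either starts a letter
`[k]`, multiplies by `κ [k]`, prolongs the outermost letter `b` to `k :: b`, or removes `b` with the
factor `κ (k :: b)`. A letter is thus a block of positions still under construction. Vacuum
coefficients show that the moment of `α` is `κ α` plus a polynomial in the cumulants of strictly
shorter subwords (`momentRest_vars`). Solving for `κ α` gives `cumPoly`, and every distribution is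
some `cumDist κ` (`eq_cumDist`).

The joint distribution of a bi-free pair depends only on its marginals, so the pair may be replaced
by two differently coloured copies of the model (`distribution_biFreeOp_eq`). The diagonal map on
letters intertwines the model for `κ + κ'` with the sum of the two copies (`cumDist_add`). Hence
`cumPoly` is additive on bi-free pairs.

Vanishing of a cumulant only asserts that some cumulant polynomial vanishes, so all of them must
take the same values. The difference of two of them has no linear term. Along `cumDist (s • κ)` it
therefore vanishes to second order in `s`, whereas additivity makes it linear in `s`; so it is zero
(`IsBiFreeCumulantPolynomial.evalMoments_eq`). It follows that a central limit distribution is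
determined by its second moments (`IsBiFreeCentralLimit.ext`).

The Fock family is the model whose cumulants are inner products on words of length two and zero
elsewhere (`distribution_fockFamily_eq_cumDist`). It is hermitian because its operators are
self-adjoint. A positive semidefinite matrix is a Gram matrix (`exists_gram`), so uniqueness
identifies the given distribution with that of a Fock family. Conversely, positivity on linear
polynomials makes the second moment matrix positive semidefinite. -/

theorem monomial_nil {κ : Type u} : monomial ([] : List κ) = 1 := rfl

theorem monomial_cons {κ : Type u} (k : κ) (l : List κ) :
    monomial (k :: l) = FreeAlgebra.ι ℂ k * monomial l := by simp [monomial]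

theorem monomial_append {κ : Type u} (l l' : List κ) :
    monomial (l ++ l') = monomial l * monomial l' := by simp [monomial]

theorem span_monomial (κ : Type u) : Submodule.span ℂ (Set.range (monomial (κ := κ))) = ⊤ := by
  refine eq_top_iff.2 fun P _ => ?_
  induction P using FreeAlgebra.induction with
  | grade0 r =>
    rw [Algebra.algebraMap_eq_smul_one]
    exact Submodule.smul_mem _ _ (Submodule.subset_span ⟨[], rfl⟩)
  | grade1 k => exact Submodule.subset_span ⟨[k], by simp [monomial]⟩
  | mul a b ha hb =>
    have h : a * b ∈ Submodule.span ℂ (Set.range (monomial (κ := κ))) *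
        Submodule.span ℂ (Set.range (monomial (κ := κ))) :=
      Submodule.mul_mem_mul (ha trivial) (hb trivial)
    rw [Submodule.span_mul_span] at h
    refine Submodule.span_mono ?_ h
    rintro _ ⟨_, ⟨l, rfl⟩, _, ⟨l', rfl⟩, rfl⟩
    exact ⟨l ++ l', monomial_append l l'⟩
  | add a b ha hb => exact add_mem (ha trivial) (hb trivial)

theorem functional_ext {κ : Type u} {E : Type v} [AddCommGroup E] [Module ℂ E]
    {φ φ' : FreeAlgebra ℂ κ →ₗ[ℂ] E} (h : ∀ l, φ (monomial l) = φ' (monomial l)) : φ = φ' :=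
  LinearMap.ext_on (span_monomial κ) (by rintro _ ⟨l, rfl⟩; exact h l)

/-- The functional `T ↦ ψ (T ξ)`. -/
def vecState {E : Type v} [AddCommGroup E] [Module ℂ E] (ψ : E →ₗ[ℂ] ℂ) (ξ : E) :
    Module.End ℂ E →ₗ[ℂ] ℂ :=
  ψ ∘ₗ LinearMap.applyₗ ξ

theorem vecState_apply {E : Type v} [AddCommGroup E] [Module ℂ E] (ψ : E →ₗ[ℂ] ℂ) (ξ : E)
    (S : Module.End ℂ E) : vecState ψ ξ S = ψ (S ξ) := rfl

theorem lift_intertwine {κ : Type u} {E : Type v} {F : Type w} [AddCommGroup E] [Module ℂ E]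
    [AddCommGroup F] [Module ℂ F] {S : κ → Module.End ℂ E} {S' : κ → Module.End ℂ F}
    (Θ : E →ₗ[ℂ] F) (h : ∀ k x, Θ (S k x) = S' k (Θ x)) (P : FreeAlgebra ℂ κ) (x : E) :
    Θ (FreeAlgebra.lift ℂ S P x) = FreeAlgebra.lift ℂ S' P (Θ x) := by
  induction P using FreeAlgebra.induction generalizing x with
  | grade0 r => simp
  | grade1 k => simp [h]
  | mul a b ha hb => simp [ha, hb]
  | add a b ha hb => simp [ha, hb]

/-- The comparison principle for models. Nothing is asked of `Θ` beyond matching vectors,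
functionals and operators; it may be neither injective nor surjective. -/
theorem distribution_eq_of_intertwine {κ : Type u} {E : Type v} {F : Type w} [AddCommGroup E]
    [Module ℂ E] [AddCommGroup F] [Module ℂ F] {S : κ → Module.End ℂ E} {S' : κ → Module.End ℂ F}
    {ψ : E →ₗ[ℂ] ℂ} {ξ : E} {ψ' : F →ₗ[ℂ] ℂ} {ξ' : F}
    (Θ : E →ₗ[ℂ] F) (hξ : Θ ξ = ξ') (hψ : ∀ x, ψ' (Θ x) = ψ x)
    (h : ∀ k x, Θ (S k x) = S' k (Θ x)) :
    distribution (vecState ψ ξ) S = distribution (vecState ψ' ξ') S' := by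
  ext P
  simp only [distribution, LinearMap.comp_apply, AlgHom.toLinearMap_apply, vecState_apply]
  rw [← hψ, lift_intertwine Θ h, hξ]

/-! ### Operators of Fock type on a tensor algebra -/

section TensorAlgebra

variable {V : Type v} [AddCommGroup V] [Module ℂ V] {W : Type w} [AddCommGroup W] [Module ℂ W]

/-- The tensor algebra is `ℂ ⊕ V ⊗ T(V)`. The induction shows that agreement at `b` propagates to
agreement at `a * b`, and then starts from `b = 1`. -/
theorem tensorAlgebra_ext_left {f g : TensorAlgebra ℂ V →ₗ[ℂ] W} (h1 : f 1 = g 1)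
    (h : ∀ b η, f (TensorAlgebra.ι ℂ b * η) = g (TensorAlgebra.ι ℂ b * η)) : f = g := by
  have key : ∀ a b : TensorAlgebra ℂ V, f b = g b → f (a * b) = g (a * b) := by
    intro a
    induction a using TensorAlgebra.induction with
    | algebraMap r => intro b hb; simp [← Algebra.smul_def, hb]
    | ι x => intro b _; exact h x b
    | mul a a' ha ha' => intro b hb; rw [mul_assoc]; exact ha _ (ha' _ hb)
    | add a a' ha ha' => intro b hb; simp [add_mul, ha _ hb, ha' _ hb]
  ext a
  simpa using key a 1 h1

theorem tensorAlgebra_ext_right {f g : TensorAlgebra ℂ V →ₗ[ℂ] W} (h1 : f 1 = g 1)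
    (h : ∀ b η, f (η * TensorAlgebra.ι ℂ b) = g (η * TensorAlgebra.ι ℂ b)) : f = g := by
  have key : ∀ a b : TensorAlgebra ℂ V, f b = g b → f (b * a) = g (b * a) := by
    intro a
    induction a using TensorAlgebra.induction with
    | algebraMap r => intro b hb; simp [← Algebra.commutes, ← Algebra.smul_def, hb]
    | ι x => intro b _; exact h x b
    | mul a a' ha ha' => intro b hb; rw [← mul_assoc]; exact ha' _ (ha _ hb)
    | add a a' ha ha' => intro b hb; simp [mul_add, ha _ hb, ha' _ hb]
  ext a
  simpa using key a 1 h1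

/-- The vacuum functional: the component in degree `0`. -/
def vac (V : Type v) [AddCommGroup V] [Module ℂ V] : TensorAlgebra ℂ V →ₗ[ℂ] ℂ :=
  (TensorAlgebra.algebraMapInv (R := ℂ) (M := V)).toLinearMap

theorem vac_one : vac V 1 = 1 := by simp [vac]

theorem vac_mul (a b : TensorAlgebra ℂ V) : vac V (a * b) = vac V a * vac V b := by simp [vac]

theorem vac_ι (x : V) : vac V (TensorAlgebra.ι ℂ x) = 0 := by
  simp [vac, TensorAlgebra.algebraMapInv]

theorem vac_algebraMap (c : ℂ) : vac V (algebraMap ℂ _ c) = c := by simp [vac]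

/-- The data of an operator of Fock type: a vector to be created, a scalar, a preservation
operator and a functional which annihilates. -/
structure OpData (V : Type v) [AddCommGroup V] [Module ℂ V] where
  create : V
  scalar : ℂ
  preserve : Module.End ℂ V
  annihilate : V →ₗ[ℂ] ℂ

namespace OpData

instance : Add (OpData V) :=
  ⟨fun d e => ⟨d.create + e.create, d.scalar + e.scalar, d.preserve + e.preserve,
    d.annihilate + e.annihilate⟩⟩

/-- The vector `v + c` in degrees `1` and `0` to which the vacuum is mapped. -/
def new (d : OpData V) : TensorAlgebra ℂ V :=
  TensorAlgebra.ι ℂ d.create + algebraMap ℂ _ d.scalar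

/-- The part of the action which modifies an outermost tensor factor. -/
def modify (d : OpData V) : V →ₗ[ℂ] TensorAlgebra ℂ V :=
  TensorAlgebra.ι ℂ ∘ₗ d.preserve + Algebra.linearMap ℂ _ ∘ₗ d.annihilate

/-- The operator given by `d`, acting on the leftmost tensor factor. -/
def left (d : OpData V) : Module.End ℂ (TensorAlgebra ℂ V) :=
  LinearMap.mulLeft ℂ d.new +
    TensorProduct.lift (LinearMap.mul ℂ (TensorAlgebra ℂ V) ∘ₗ d.modify) ∘ₗ peelLeft

/-- The operator given by `d`, acting on the rightmost tensor factor. -/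
def right (d : OpData V) : Module.End ℂ (TensorAlgebra ℂ V) :=
  LinearMap.mulRight ℂ d.new +
    TensorProduct.lift ((LinearMap.mul ℂ (TensorAlgebra ℂ V)).flip ∘ₗ d.modify).flip ∘ₗ peelRight

theorem left_one (d : OpData V) : d.left 1 = d.new := by
  simp [left, peelLeft_one]

theorem right_one (d : OpData V) : d.right 1 = d.new := by
  simp [right, peelRight_one]

theorem left_ι_mul (d : OpData V) (x : V) (η : TensorAlgebra ℂ V) :
    d.left (TensorAlgebra.ι ℂ x * η) = d.new * (TensorAlgebra.ι ℂ x * η) + d.modify x * η := by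
  simp [left, peelLeft_ι_mul]

theorem right_mul_ι (d : OpData V) (x : V) (η : TensorAlgebra ℂ V) :
    d.right (η * TensorAlgebra.ι ℂ x) = η * TensorAlgebra.ι ℂ x * d.new + η * d.modify x := by
  simp [right, peelRight_mul_ι]

theorem new_add (d e : OpData V) : (d + e).new = d.new + e.new := by
  change TensorAlgebra.ι ℂ (d.create + e.create) + algebraMap ℂ _ (d.scalar + e.scalar) = _
  simp only [new, map_add]; abel

theorem modify_add (d e : OpData V) : (d + e).modify = d.modify + e.modify := by
  change TensorAlgebra.ι ℂ ∘ₗ (d.preserve + e.preserve) +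
    Algebra.linearMap ℂ _ ∘ₗ (d.annihilate + e.annihilate) = _
  simp only [modify, LinearMap.comp_add]; abel

theorem left_add (d e : OpData V) : (d + e).left = d.left + e.left := by
  refine tensorAlgebra_ext_left ?_ fun b η => ?_
  · simp [left_one, new_add]
  · simp [left_ι_mul, new_add, modify_add, add_mul]; abel

theorem right_add (d e : OpData V) : (d + e).right = d.right + e.right := by
  refine tensorAlgebra_ext_right ?_ fun b η => ?_
  · simp [right_one, new_add]
  · simp [right_mul_ι, new_add, modify_add, mul_add]; abel

/-- Only the leftmost factor is touched, so `η` is a spectator unless `ζ` has a component in degree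
zero. The term `d.left η - d.new * η` in `key` measures the failure on that component. -/
theorem left_mul (d : OpData V) (ζ η : TensorAlgebra ℂ V) (h : vac V ζ = 0) :
    d.left (ζ * η) = d.left ζ * η := by
  have key : d.left ∘ₗ LinearMap.mulRight ℂ η =
      LinearMap.mulRight ℂ η ∘ₗ d.left + (vac V).smulRight (d.left η - d.new * η) := by
    refine tensorAlgebra_ext_left ?_ fun b η => ?_
    · simp [left_one, vac_one]
    · simp [left_ι_mul, vac_mul, vac_ι, mul_assoc, add_mul]
  simpa [h] using LinearMap.congr_fun key ζ

theorem right_mul (d : OpData V) (ζ η : TensorAlgebra ℂ V) (h : vac V ζ = 0) :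
    d.right (η * ζ) = η * d.right ζ := by
  have key : d.right ∘ₗ LinearMap.mulLeft ℂ η =
      LinearMap.mulLeft ℂ η ∘ₗ d.right + (vac V).smulRight (d.right η - η * d.new) := by
    refine tensorAlgebra_ext_right ?_ fun b ζ => ?_
    · simp [right_one, vac_one]
    · simp [← mul_assoc, right_mul_ι, vac_mul, vac_ι, mul_add]
  simpa [h] using LinearMap.congr_fun key ζ

/-- `Δ` is compatible with the data `d` and `e`. -/
structure Compat (Δ : V →ₗ[ℂ] W) (d : OpData V) (e : OpData W) : Prop where
  create : Δ d.create = e.create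
  scalar : d.scalar = e.scalar
  preserve : ∀ x, Δ (d.preserve x) = e.preserve (Δ x)
  annihilate : ∀ x, e.annihilate (Δ x) = d.annihilate x

end OpData

/-- The algebra homomorphism of tensor algebras induced by a linear map. -/
def tmap (Δ : V →ₗ[ℂ] W) : TensorAlgebra ℂ V →ₐ[ℂ] TensorAlgebra ℂ W :=
  TensorAlgebra.lift ℂ (TensorAlgebra.ι ℂ ∘ₗ Δ)

theorem tmap_ι (Δ : V →ₗ[ℂ] W) (x : V) :
    tmap Δ (TensorAlgebra.ι ℂ x) = TensorAlgebra.ι ℂ (Δ x) := by simp [tmap]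

theorem vac_tmap (Δ : V →ₗ[ℂ] W) (η : TensorAlgebra ℂ V) : vac W (tmap Δ η) = vac V η := by
  have key : vac W ∘ₗ (tmap Δ).toLinearMap = vac V :=
    tensorAlgebra_ext_left (by simp [vac_one]) fun b η => by simp [vac_mul, tmap_ι, vac_ι]
  exact LinearMap.congr_fun key η

namespace OpData

theorem Compat.new {Δ : V →ₗ[ℂ] W} {d : OpData V} {e : OpData W} (h : Compat Δ d e) :
    tmap Δ d.new = e.new := by
  simp [OpData.new, tmap_ι, h.create, h.scalar]

theorem Compat.modify {Δ : V →ₗ[ℂ] W} {d : OpData V} {e : OpData W} (h : Compat Δ d e) (x : V) :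
    tmap Δ (d.modify x) = e.modify (Δ x) := by
  simp [OpData.modify, tmap_ι, h.preserve, h.annihilate]

theorem Compat.left {Δ : V →ₗ[ℂ] W} {d : OpData V} {e : OpData W} (h : Compat Δ d e)
    (η : TensorAlgebra ℂ V) : tmap Δ (d.left η) = e.left (tmap Δ η) := by
  have key : (tmap Δ).toLinearMap ∘ₗ d.left = e.left ∘ₗ (tmap Δ).toLinearMap :=
    tensorAlgebra_ext_left (by simp [left_one, h.new]) fun b η => by
      simp [left_ι_mul, tmap_ι, h.new, h.modify]
  exact LinearMap.congr_fun key η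

theorem Compat.right {Δ : V →ₗ[ℂ] W} {d : OpData V} {e : OpData W} (h : Compat Δ d e)
    (η : TensorAlgebra ℂ V) : tmap Δ (d.right η) = e.right (tmap Δ η) := by
  have key : (tmap Δ).toLinearMap ∘ₗ d.right = e.right ∘ₗ (tmap Δ).toLinearMap :=
    tensorAlgebra_ext_right (by simp [right_one, h.new]) fun b η => by
      simp [right_mul_ι, tmap_ι, h.new, h.modify]
  exact LinearMap.congr_fun key η

/-- Used for an operator of one colour meeting tensors of the other colour: only creation and the
scalar survive. -/
theorem left_tmap_of_modify_eq_zero (Δ : V →ₗ[ℂ] W) (e : OpData W) (h : e.modify ∘ₗ Δ = 0)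
    (η : TensorAlgebra ℂ V) : e.left (tmap Δ η) = e.new * tmap Δ η := by
  have h' : ∀ x, e.modify (Δ x) = 0 := LinearMap.congr_fun h
  have key : e.left ∘ₗ (tmap Δ).toLinearMap = LinearMap.mulLeft ℂ e.new ∘ₗ (tmap Δ).toLinearMap :=
    tensorAlgebra_ext_left (by simp [left_one]) fun b η => by
      simp [left_ι_mul, tmap_ι, h']
  exact LinearMap.congr_fun key η

theorem right_tmap_of_modify_eq_zero (Δ : V →ₗ[ℂ] W) (e : OpData W) (h : e.modify ∘ₗ Δ = 0)
    (η : TensorAlgebra ℂ V) : e.right (tmap Δ η) = tmap Δ η * e.new := by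
  have h' : ∀ x, e.modify (Δ x) = 0 := LinearMap.congr_fun h
  have key : e.right ∘ₗ (tmap Δ).toLinearMap =
      LinearMap.mulRight ℂ e.new ∘ₗ (tmap Δ).toLinearMap :=
    tensorAlgebra_ext_right (by simp [right_one]) fun b η => by
      simp [right_mul_ι, tmap_ι, h']
  exact LinearMap.congr_fun key η

end OpData

variable {I J : Type u}

/-- The two-faced family of operators with data `d`: the left variables act on the left, the right
variables on the right. -/
def faceOp (d : I ⊕ J → OpData V) (k : I ⊕ J) : Module.End ℂ (TensorAlgebra ℂ V) :=
  Sum.elim (fun _ => (d k).left) (fun _ => (d k).right) k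

theorem faceOp_one (d : I ⊕ J → OpData V) (k : I ⊕ J) : faceOp d k 1 = (d k).new := by
  cases k <;> simp [faceOp, OpData.left_one, OpData.right_one]

theorem faceOp_add (d e : I ⊕ J → OpData V) : faceOp (d + e) = faceOp d + faceOp e := by
  funext k
  cases k <;> simp [faceOp, OpData.left_add, OpData.right_add]

theorem faceOp_compat {Δ : V →ₗ[ℂ] W} {d : I ⊕ J → OpData V} {e : I ⊕ J → OpData W}
    (h : ∀ k, OpData.Compat Δ (d k) (e k)) (k : I ⊕ J) (η : TensorAlgebra ℂ V) :
    tmap Δ (faceOp d k η) = faceOp e k (tmap Δ η) := by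
  cases k
  · exact (h _).left η
  · exact (h _).right η

/-- The vacuum distribution of the family of operators with data `d`. -/
def vacDist (d : I ⊕ J → OpData V) : FreeAlgebra ℂ (I ⊕ J) →ₗ[ℂ] ℂ :=
  distribution (vecState (vac V) 1) (faceOp d)

theorem vacDist_one (d : I ⊕ J → OpData V) : vacDist d 1 = 1 := by
  simp [vacDist, distribution, vecState_apply, vac_one]

/-- A compatible map of letters extends multiplicatively to tensor words, preserves the vacuum and
intertwines both faces. -/
theorem vacDist_compat {Δ : V →ₗ[ℂ] W} {d : I ⊕ J → OpData V} {e : I ⊕ J → OpData W}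
    (h : ∀ k, OpData.Compat Δ (d k) (e k)) : vacDist d = vacDist e :=
  distribution_eq_of_intertwine (tmap Δ).toLinearMap (by simp) (vac_tmap Δ) (faceOp_compat h)

end TensorAlgebra

/-! ### Maps out of the free product of spaces with state-vectors -/

section FreeProductMaps

variable {Y : Bool → StateVectorSpace.{u}} {V : Type v} [AddCommGroup V] [Module ℂ V]

/-- The algebra homomorphism given on `Y_t°` by `γ_t`. -/
def ambientLift (γ : ∀ t, Y t →ₗ[ℂ] TensorAlgebra ℂ V) : Ambient Y →ₐ[ℂ] TensorAlgebra ℂ V :=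
  TensorAlgebra.lift ℂ
    (DirectSum.toModule ℂ Bool _ fun t => γ t ∘ₗ (Y t).centered.subtype)

theorem ambientLift_letter (γ : ∀ t, Y t →ₗ[ℂ] TensorAlgebra ℂ V) (t : Bool) (y : (Y t).centered) :
    ambientLift γ (letter Y t y) = γ t y := by
  simp [ambientLift, letter]

theorem ambientLift_incl {γ : ∀ t, Y t →ₗ[ℂ] TensorAlgebra ℂ V} (hγ : ∀ t, γ t (Y t).ξ = 1)
    (t : Bool) (y : Y t) : ambientLift γ (incl Y t y) = γ t y := by
  have h : ((Y t).center y : Y t) = y - (Y t).ψ y • (Y t).ξ := rfl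
  simp [incl, ambientLift_letter, h, hγ, Algebra.algebraMap_eq_smul_one]

theorem ambient_ext_left {W : Type w} [AddCommGroup W] [Module ℂ W] {f g : Ambient Y →ₗ[ℂ] W}
    (h1 : f 1 = g 1)
    (h : ∀ t (y : (Y t).centered) η, f (letter Y t y * η) = g (letter Y t y * η)) : f = g := by
  refine tensorAlgebra_ext_left h1 fun b η => ?_
  induction b using DirectSum.induction_on with
  | zero => simp
  | of t y => simpa [letter, DirectSum.lof_eq_of] using h t y η
  | add a b ha hb => simp [add_mul, ha, hb]

theorem ambient_ext_right {W : Type w} [AddCommGroup W] [Module ℂ W] {f g : Ambient Y →ₗ[ℂ] W}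
    (h1 : f 1 = g 1)
    (h : ∀ t (y : (Y t).centered) η, f (η * letter Y t y) = g (η * letter Y t y)) : f = g := by
  refine tensorAlgebra_ext_right h1 fun b η => ?_
  induction b using DirectSum.induction_on with
  | zero => simp
  | of t y => simpa [letter, DirectSum.lof_eq_of] using h t y η
  | add a b ha hb => simp [mul_add, ha, hb]

theorem vac_ambientLift {γ : ∀ t, Y t →ₗ[ℂ] TensorAlgebra ℂ V}
    (hγ : ∀ t y, vac V (γ t y) = (Y t).ψ y) (η : Ambient Y) :
    vac V (ambientLift γ η) = vac _ η := by
  have key : vac V ∘ₗ (ambientLift γ).toLinearMap = vac _ :=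
    ambient_ext_left (by simp [vac_one]) fun t y η => by
      have hy : (Y t).ψ y = 0 := y.2
      have h2 : vac _ (letter Y t y) = 0 := vac_ι _
      simp [vac_mul, ambientLift_letter, hγ, hy, h2]
  exact LinearMap.congr_fun key η

/-- The hypotheses on `Λ` are the three cases that determine the left action: the vacuum, a first
letter from the same space, a first letter from another space. -/
theorem ambientLift_left {γ : ∀ t, Y t →ₗ[ℂ] TensorAlgebra ℂ V} (hγ : ∀ t, γ t (Y t).ξ = 1)
    {t : Bool} {S : Module.End ℂ (Y t)} {Λ : Module.End ℂ (TensorAlgebra ℂ V)}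
    (h1 : Λ 1 = γ t (S (Y t).ξ))
    (h2 : ∀ (y : (Y t).centered) η, Λ (γ t y * η) = γ t (S y) * η)
    (h3 : ∀ s, s ≠ t → ∀ (y : (Y s).centered) η,
      Λ (γ s y * η) = γ t (S (Y t).ξ) * (γ s y * η)) (η : Ambient Y) :
    ambientLift γ (ambientLeft Y t S η) = Λ (ambientLift γ η) := by
  have key : (ambientLift γ).toLinearMap ∘ₗ ambientLeft Y t S =
      Λ ∘ₗ (ambientLift γ).toLinearMap := by
    refine ambient_ext_left ?_ fun s y η => ?_
    · simp [ambientLeft_one, ambientLift_incl hγ, h1]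
    · by_cases h : s = t
      · subst h
        simp [ambientLeft_same, ambientLift_letter, ambientLift_incl hγ, h2]
      · simp [ambientLeft_ne Y h, ambientLift_letter, ambientLift_incl hγ, h3 s h]
  exact LinearMap.congr_fun key η

theorem ambientLift_right {γ : ∀ t, Y t →ₗ[ℂ] TensorAlgebra ℂ V} (hγ : ∀ t, γ t (Y t).ξ = 1)
    {t : Bool} {S : Module.End ℂ (Y t)} {Λ : Module.End ℂ (TensorAlgebra ℂ V)}
    (h1 : Λ 1 = γ t (S (Y t).ξ))
    (h2 : ∀ (y : (Y t).centered) η, Λ (η * γ t y) = η * γ t (S y))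
    (h3 : ∀ s, s ≠ t → ∀ (y : (Y s).centered) η,
      Λ (η * γ s y) = η * γ s y * γ t (S (Y t).ξ)) (η : Ambient Y) :
    ambientLift γ (ambientRight Y t S η) = Λ (ambientLift γ η) := by
  have key : (ambientLift γ).toLinearMap ∘ₗ ambientRight Y t S =
      Λ ∘ₗ (ambientLift γ).toLinearMap := by
    refine ambient_ext_right ?_ fun s y η => ?_
    · simp [ambientRight_one, ambientLift_incl hγ, h1]
    · by_cases h : s = t
      · subst h
        simp [ambientRight_same, ambientLift_letter, ambientLift_incl hγ, h2]
      · simp [ambientRight_ne Y h, ambientLift_letter, ambientLift_incl hγ, h3 s h]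
  exact LinearMap.congr_fun key η

end FreeProductMaps

/-! ### Joint distributions of bi-free pairs -/

section Joint

variable {I J : Type u}

/-- The family of operators `λ_t(S_{t,i})`, `ρ_t(S_{t,j})` on the free product. -/
def biFreeOp (X : Bool → StateVectorSpace.{u}) (S : ∀ t, I ⊕ J → Module.End ℂ (X t))
    (p : Bool × (I ⊕ J)) : Module.End ℂ (freeProduct X) :=
  Sum.elim (fun i => leftOp X p.1 (S p.1 (Sum.inl i)))
    (fun j => rightOp X p.1 (S p.1 (Sum.inr j))) p.2

/-- The family of operators `λ_t(S_{t,i})`, `ρ_t(S_{t,j})` on all tensor words. -/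
def ambientOp (X : Bool → StateVectorSpace.{u}) (S : ∀ t, I ⊕ J → Module.End ℂ (X t))
    (p : Bool × (I ⊕ J)) : Module.End ℂ (Ambient X) :=
  Sum.elim (fun i => ambientLeft X p.1 (S p.1 (Sum.inl i)))
    (fun j => ambientRight X p.1 (S p.1 (Sum.inr j))) p.2

/-- The vacuum distribution of `ambientOp`. -/
def ambientDist (X : Bool → StateVectorSpace.{u}) (S : ∀ t, I ⊕ J → Module.End ℂ (X t)) :
    FreeAlgebra ℂ (Bool × (I ⊕ J)) →ₗ[ℂ] ℂ :=
  distribution (vecState (vac (⨁ t, (X t).centered)) 1) (ambientOp X S)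

/-- The free product contains the vacuum and is invariant, so moments may be computed on all tensor
words, where maps are defined freely on letters. -/
theorem distribution_biFreeOp (X : Bool → StateVectorSpace.{u})
    (S : ∀ t, I ⊕ J → Module.End ℂ (X t)) :
    distribution (freeProduct X).expectation (biFreeOp X S) =
      ambientDist X S := by
  refine distribution_eq_of_intertwine (ψ := (freeProduct X).ψ) (ξ := (freeProduct X).ξ)
    (freeProductSpace X).subtype rfl (fun _ => rfl) ?_
  rintro ⟨t, i | j⟩ x <;> rfl

/-- The left regular representation of the free algebra, with the state `μ`. -/
def regularSpace (μ : FreeAlgebra ℂ (I ⊕ J) →ₗ[ℂ] ℂ) (h : μ 1 = 1) : StateVectorSpace.{u} where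
  carrier := FreeAlgebra ℂ (I ⊕ J)
  ψ := μ
  ξ := 1
  ψ_ξ := h

theorem incl_ξ (X : Bool → StateVectorSpace.{u}) (t : Bool) : incl X t (X t).ξ = 1 := by
  have h : (X t).center (X t).ξ = 0 := by
    ext
    change (X t).ξ - (X t).ψ (X t).ξ • (X t).ξ = 0
    simp [(X t).ψ_ξ]
  simp [incl, h, (X t).ψ_ξ]

theorem incl_centered (X : Bool → StateVectorSpace.{u}) (t : Bool) (x : (X t).centered) :
    incl X t x = letter X t x := by
  have h0 : (X t).ψ x = 0 := x.2
  have h : (X t).center x = x := by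
    ext
    change (x : X t) - (X t).ψ x • (X t).ξ = x
    simp [h0]
  simp [incl, h, h0]

theorem vac_incl (X : Bool → StateVectorSpace.{u}) (t : Bool) (x : X t) :
    vac (⨁ t, (X t).centered) (incl X t x) = (X t).ψ x := by
  have : vac _ (letter X t ((X t).center x)) = 0 := vac_ι _
  simp [incl, this, vac_algebraMap]

/-- Functoriality of the free product in spaces with state-vector. Applied to orbit maps, it shows
that the joint distribution depends only on the marginals. -/
theorem distribution_ambientOp_map {Y X : Bool → StateVectorSpace.{u}}
    {S' : ∀ t, I ⊕ J → Module.End ℂ (Y t)} {S : ∀ t, I ⊕ J → Module.End ℂ (X t)}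
    (g : ∀ t, Y t →ₗ[ℂ] X t) (gψ : ∀ t y, (X t).ψ (g t y) = (Y t).ψ y)
    (gξ : ∀ t, g t (Y t).ξ = (X t).ξ) (gS : ∀ t k y, g t (S' t k y) = S t k (g t y)) :
    ambientDist Y S' =
      ambientDist X S := by
  let γ : ∀ t, Y t →ₗ[ℂ] Ambient X := fun t => incl X t ∘ₗ g t
  have γξ : ∀ t, γ t (Y t).ξ = 1 := fun t => by simp [γ, gξ, incl_ξ]
  -- Since `g t` preserves the functionals, it maps `Y_t°` into `X_t°`, so letters go to letters.
  have γc : ∀ t (y : (Y t).centered), ∃ x : (X t).centered, γ t y = letter X t x ∧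
      g t y = x := fun t y => by
    have h0 : (X t).ψ (g t y) = 0 := (gψ t y).trans y.2
    exact ⟨⟨g t y, h0⟩, incl_centered X t ⟨g t y, h0⟩, rfl⟩
  have γψ : ∀ t y, vac _ (γ t y) = (Y t).ψ y := fun t y => (vac_incl X t _).trans (gψ t y)
  refine distribution_eq_of_intertwine (ambientLift γ).toLinearMap (by simp)
    (vac_ambientLift γψ) ?_
  rintro ⟨t, i | j⟩ η
  · refine ambientLift_left (t := t) γξ ?_ ?_ ?_ η
    · change ambientLeft X t (S t (Sum.inl i)) _ = _
      rw [ambientLeft_one, ← gξ, ← gS]; rfl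
    · intro y η
      obtain ⟨x, hx, hx'⟩ := γc t y
      change ambientLeft X t (S t (Sum.inl i)) _ = _
      rw [hx, ambientLeft_same, ← hx', ← gS]; rfl
    · intro s hs y η
      obtain ⟨x, hx, hx'⟩ := γc s y
      change ambientLeft X t (S t (Sum.inl i)) _ = _
      rw [hx, ambientLeft_ne X hs, ← gξ t, ← gS]; rfl
  · refine ambientLift_right (t := t) γξ ?_ ?_ ?_ η
    · change ambientRight X t (S t (Sum.inr j)) _ = _
      rw [ambientRight_one, ← gξ, ← gS]; rfl
    · intro y η
      obtain ⟨x, hx, hx'⟩ := γc t y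
      change ambientRight X t (S t (Sum.inr j)) _ = _
      rw [hx, ambientRight_same, ← hx', ← gS]; rfl
    · intro s hs y η
      obtain ⟨x, hx, hx'⟩ := γc s y
      change ambientRight X t (S t (Sum.inr j)) _ = _
      rw [hx, ambientRight_ne X hs, ← gξ t, ← gS]; rfl

variable {V : Type v} [AddCommGroup V] [Module ℂ V]

/-- The data `d` placed in the summand with index `t`. -/
def OpData.color (t : Bool) (d : OpData V) : OpData (Bool → V) where
  create := LinearMap.single ℂ (fun _ => V) t d.create
  scalar := d.scalar
  preserve := LinearMap.single ℂ (fun _ => V) t ∘ₗ d.preserve ∘ₗ LinearMap.proj t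
  annihilate := d.annihilate ∘ₗ LinearMap.proj t

theorem OpData.compat_color (t : Bool) (d : OpData V) :
    OpData.Compat (LinearMap.single ℂ (fun _ => V) t) d (d.color t) where
  create := rfl
  scalar := rfl
  preserve x := by simp [OpData.color]
  annihilate x := by simp [OpData.color]

theorem OpData.modify_color_ne {s t : Bool} (h : s ≠ t) (d : OpData V) :
    (d.color t).modify ∘ₗ LinearMap.single ℂ (fun _ => V) s = 0 := by
  ext x
  simp [OpData.modify, OpData.color, Pi.single_eq_of_ne (Ne.symm h)]

/-- The operators with data `d t` on the tensor algebra of two copies of `V`. -/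
def colorOp (d : Bool → I ⊕ J → OpData V) (p : Bool × (I ⊕ J)) :
    Module.End ℂ (TensorAlgebra ℂ (Bool → V)) :=
  faceOp (fun k => (d p.1 k).color p.1) p.2

/-- The vacuum distribution of `colorOp`. -/
def colorDist (d : Bool → I ⊕ J → OpData V) : FreeAlgebra ℂ (Bool × (I ⊕ J)) →ₗ[ℂ] ℂ :=
  distribution (vecState (vac (Bool → V)) 1) (colorOp d)

/-- A letter from `Y_t°` becomes a whole tensor of colour `t` without vacuum component. An operator
of colour `t` acts on this factor alone by `OpData.left_mul`; on a factor of the other colour it can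
only create or multiply by its scalar, which is the free product rule. -/
theorem distribution_ambientOp_color {Y : Bool → StateVectorSpace.{u}}
    {S : ∀ t, I ⊕ J → Module.End ℂ (Y t)} {d : Bool → I ⊕ J → OpData V}
    (g : ∀ t, Y t →ₗ[ℂ] TensorAlgebra ℂ V) (gψ : ∀ t y, vac _ (g t y) = (Y t).ψ y)
    (gξ : ∀ t, g t (Y t).ξ = 1) (gS : ∀ t k y, g t (S t k y) = faceOp (d t) k (g t y)) :
    ambientDist Y S =
      colorDist d := by
  let γ : ∀ t, Y t →ₗ[ℂ] TensorAlgebra ℂ (Bool → V) := fun t =>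
    (tmap (LinearMap.single ℂ (fun _ => V) t)).toLinearMap ∘ₗ g t
  have γξ : ∀ t, γ t (Y t).ξ = 1 := fun t => by simp [γ, gξ]
  have γψ : ∀ t y, vac _ (γ t y) = (Y t).ψ y := fun t y => by
    simp [γ, vac_tmap, gψ]
  have γ0 : ∀ t (y : (Y t).centered), vac _ (γ t y) = 0 := fun t y => (γψ t y).trans y.2
  have γS : ∀ t k y, γ t (S t k y) = colorOp d (t, k) (γ t y) := fun t k y => by
    change tmap _ (g t _) = _
    rw [gS, faceOp_compat fun k => (d t k).compat_color t]; rfl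
  have γ1 : ∀ t k, γ t (S t k (Y t).ξ) = ((d t k).color t).new := fun t k => by
    rw [γS, γξ]; exact faceOp_one _ _
  refine distribution_eq_of_intertwine (ambientLift γ).toLinearMap (by simp)
    (vac_ambientLift γψ) ?_
  rintro ⟨t, i | j⟩ η
  · refine ambientLift_left (t := t) γξ ?_ ?_ ?_ η
    · rw [γ1]; exact faceOp_one _ _
    · intro y η
      rw [γS]
      exact ((d t (Sum.inl i)).color t).left_mul _ η (γ0 t y)
    · intro s hs y η
      rw [γ1, ← mul_assoc]
      refine (((d t (Sum.inl i)).color t).left_mul _ η (γ0 s y)).trans (congrArg (· * η) ?_)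
      exact OpData.left_tmap_of_modify_eq_zero _ _ (OpData.modify_color_ne hs _) (g s y)
  · refine ambientLift_right (t := t) γξ ?_ ?_ ?_ η
    · rw [γ1]; exact faceOp_one _ _
    · intro y η
      rw [γS]
      exact ((d t (Sum.inr j)).color t).right_mul _ η (γ0 t y)
    · intro s hs y η
      rw [γ1, mul_assoc]
      refine (((d t (Sum.inr j)).color t).right_mul _ η (γ0 s y)).trans (congrArg (η * ·) ?_)
      exact OpData.right_tmap_of_modify_eq_zero _ _ (OpData.modify_color_ne hs _) (g s y)

/-- The orbit map `P ↦ P(S) ξ`. -/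
def orbit {κ : Type u} {E : Type w} [AddCommGroup E] [Module ℂ E] (S : κ → Module.End ℂ E)
    (ξ : E) : FreeAlgebra ℂ κ →ₗ[ℂ] E :=
  LinearMap.applyₗ ξ ∘ₗ (FreeAlgebra.lift ℂ S).toLinearMap

theorem orbit_one {κ : Type u} {E : Type w} [AddCommGroup E] [Module ℂ E]
    (S : κ → Module.End ℂ E) (ξ : E) : orbit S ξ 1 = ξ := by simp [orbit]

theorem orbit_mul {κ : Type u} {E : Type w} [AddCommGroup E] [Module ℂ E]
    (S : κ → Module.End ℂ E) (ξ : E) (k : κ) (P : FreeAlgebra ℂ κ) :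
    orbit S ξ (FreeAlgebra.ι ℂ k * P) = S k (orbit S ξ P) := by simp [orbit]

/-- The joint distribution of a bi-free pair with the marginals `vacDist (d t)`. -/
theorem distribution_biFreeOp_eq {X : Bool → StateVectorSpace.{u}}
    {S : ∀ t, I ⊕ J → Module.End ℂ (X t)} {d : Bool → I ⊕ J → OpData V}
    (h : ∀ t, distribution (X t).expectation (S t) = vacDist (d t)) :
    distribution (freeProduct X).expectation (biFreeOp X S) =
      colorDist d := by
  -- The regular representation with state `vacDist (d t)` maps by orbits both to `X t` and to the
  -- tensor algebra, so the two joint distributions agree with a common third one.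
  have h1 := distribution_ambientOp_map
    (Y := fun t => regularSpace (vacDist (d t)) (vacDist_one _)) (X := X) (S := S)
    (S' := fun _ k => LinearMap.mulLeft ℂ (FreeAlgebra.ι ℂ k)) (fun t => orbit (S t) (X t).ξ)
    (fun t y => LinearMap.congr_fun (h t) y) (fun t => orbit_one _ _) fun t k y => orbit_mul _ _ k y
  have h2 := distribution_ambientOp_color
    (Y := fun t => regularSpace (vacDist (d t)) (vacDist_one _)) (d := d)
    (S := fun _ k => LinearMap.mulLeft ℂ (FreeAlgebra.ι ℂ k)) (fun t => orbit (faceOp (d t)) 1)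
    (fun t y => rfl) (fun t => orbit_one _ _) fun t k y => orbit_mul _ _ k y
  rw [distribution_biFreeOp, ← h1, h2]

theorem distribution_regularSpace (μ : FreeAlgebra ℂ (I ⊕ J) →ₗ[ℂ] ℂ) (h : μ 1 = 1) :
    distribution (regularSpace μ h).expectation
      (fun k => LinearMap.mulLeft ℂ (FreeAlgebra.ι ℂ k)) = μ := by
  ext P
  have : FreeAlgebra.lift ℂ (fun k : I ⊕ J => LinearMap.mulLeft ℂ (FreeAlgebra.ι ℂ k)) =
      Algebra.lmul ℂ (FreeAlgebra ℂ (I ⊕ J)) := by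
    ext k; simp
  change μ (FreeAlgebra.lift ℂ (fun k : I ⊕ J => LinearMap.mulLeft ℂ (FreeAlgebra.ι ℂ k)) P 1) = _
  rw [this]; simp

theorem distribution_colorOp (d : Bool → I ⊕ J → OpData V) (t : Bool) :
    distribution (vecState (vac _) 1) (fun k => colorOp d (t, k)) = vacDist (d t) :=
  (vacDist_compat fun k => (d t k).compat_color t).symm

/-- Provides bi-free pairs with prescribed marginals, on which an arbitrary cumulant polynomial can
be tested. -/
theorem isBiFree_colorOp (d : Bool → I ⊕ J → OpData V) :
    IsBiFree (I := I) (J := J) (vecState (vac (Bool → V)) 1) fun t k => colorOp d (t, k) :=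
  ⟨fun t => regularSpace (vacDist (d t)) (vacDist_one _),
    fun _ k => LinearMap.mulLeft ℂ (FreeAlgebra.ι ℂ k),
    (distribution_biFreeOp_eq fun _ => distribution_regularSpace _ _).symm⟩

end Joint

/-! ### Polynomials in families with a given distribution -/

section Sum

variable {κ : Type u} {A : Type v} [Ring A] [Algebra ℂ A] {B : Type w} [Ring B] [Algebra ℂ B]

theorem distribution_comp_lift {κ' : Type u} (φ : A →ₗ[ℂ] ℂ) (z : κ → A)
    (f : κ' → FreeAlgebra ℂ κ) :
    distribution φ (fun k => FreeAlgebra.lift ℂ z (f k)) =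
      distribution φ z ∘ₗ (FreeAlgebra.lift ℂ f).toLinearMap := by
  have : FreeAlgebra.lift ℂ (fun k => FreeAlgebra.lift ℂ z (f k)) =
      (FreeAlgebra.lift ℂ z).comp (FreeAlgebra.lift ℂ f) := by
    ext k; simp
  simp [distribution, this, LinearMap.comp_assoc, AlgHom.comp_toLinearMap]

/-- Polynomials in families with the same distribution have the same distribution. -/
theorem distribution_lift_congr {κ' : Type u} {φ : A →ₗ[ℂ] ℂ} {z : κ → A} {φ' : B →ₗ[ℂ] ℂ}
    {z' : κ → B} (h : distribution φ z = distribution φ' z') (f : κ' → FreeAlgebra ℂ κ) :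
    distribution φ (fun k => FreeAlgebra.lift ℂ z (f k)) =
      distribution φ' (fun k => FreeAlgebra.lift ℂ z' (f k)) := by
  rw [distribution_comp_lift, distribution_comp_lift, h]

end Sum

/-! ### Distributions with prescribed cumulants -/

section Canonical

variable {I J : Type u}

/-- The operator of the variable `k` in the canonical model for cumulants `κ`. The letters of
tensor words are the words `b` formed by the positions of a block which is not yet complete. -/
def wordData (κ : List (I ⊕ J) → ℂ) (k : I ⊕ J) : OpData (List (I ⊕ J) →₀ ℂ) where
  create := Finsupp.single [k] 1
  scalar := κ [k]
  preserve := Finsupp.lmapDomain ℂ ℂ (k :: ·)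
  annihilate := Finsupp.linearCombination ℂ fun b => κ (k :: b)

/-- The distribution with bi-free cumulants `κ`. -/
def cumDist (κ : List (I ⊕ J) → ℂ) : FreeAlgebra ℂ (I ⊕ J) →ₗ[ℂ] ℂ := vacDist (wordData κ)

/-- Along the diagonal, the created letters of the two colours add up to a diagonal vector,
prolongation is the same in both components, and the annihilating functionals add. -/
theorem wordData_compat_add (κ : Bool → List (I ⊕ J) → ℂ) (k : I ⊕ J) :
    OpData.Compat (LinearMap.pi fun _ : Bool => LinearMap.id) (wordData (κ false + κ true) k)
      ((wordData (κ false) k).color false + (wordData (κ true) k).color true) where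
  create := by
    change _ = LinearMap.single ℂ (fun _ => List (I ⊕ J) →₀ ℂ) false _ +
      LinearMap.single ℂ (fun _ => List (I ⊕ J) →₀ ℂ) true _
    ext b : 1
    cases b <;> simp [wordData]
  scalar := rfl
  preserve x := by
    change _ = LinearMap.single ℂ (fun _ => List (I ⊕ J) →₀ ℂ) false _ +
      LinearMap.single ℂ (fun _ => List (I ⊕ J) →₀ ℂ) true _
    ext b : 1
    cases b <;> simp [wordData]
  annihilate x := by
    change (wordData (κ false) k).annihilate x + (wordData (κ true) k).annihilate x = _
    simp [wordData, Finsupp.linearCombination_apply, Finsupp.sum, mul_add, Finset.sum_add_distrib]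

theorem cumDist_add (κ : Bool → List (I ⊕ J) → ℂ) :
    distribution (vecState (vac (Bool → (List (I ⊕ J) →₀ ℂ))) 1)
      (fun k => colorOp (fun t => wordData (κ t)) (false, k) +
      colorOp (fun t => wordData (κ t)) (true, k)) = cumDist (κ false + κ true) := by
  refine ((vacDist_compat (wordData_compat_add κ)).trans ?_).symm
  exact congrArg (distribution (vecState (vac (Bool → (List (I ⊕ J) →₀ ℂ))) 1))
    (faceOp_add (fun k => (wordData (κ false) k).color false)
      (fun k => (wordData (κ true) k).color true))

/-! ### Moments as polynomials in the cumulants -/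

/-- The terms of the action of the variable `k`, acting on the left, on a tensor word. -/
def leftTerms (k : I ⊕ J) : List (List (I ⊕ J)) →
    List (MvPolynomial (List (I ⊕ J)) ℂ × List (List (I ⊕ J)))
  | [] => [(1, [[k]]), (MvPolynomial.X [k], [])]
  | b :: bs => [(1, [k] :: b :: bs), (MvPolynomial.X [k], b :: bs), (1, (k :: b) :: bs),
      (MvPolynomial.X (k :: b), bs)]

/-- The terms of the action of the variable `k` on a tensor word. -/
def terms (k : I ⊕ J) (bs : List (List (I ⊕ J))) :
    List (MvPolynomial (List (I ⊕ J)) ℂ × List (List (I ⊕ J))) :=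
  Sum.elim (fun _ => leftTerms k bs)
    (fun _ => (leftTerms k bs.reverse).map fun o => (o.1, o.2.reverse)) k

/-- The vacuum coefficient of the operator word with reversed index word `w`, applied to the tensor
word `bs`, as a polynomial in the cumulants. -/
def vacPoly : List (I ⊕ J) → List (List (I ⊕ J)) → MvPolynomial (List (I ⊕ J)) ℂ
  | [], bs => if bs = [] then 1 else 0
  | k :: w, bs => ((terms k bs).map fun o => o.1 * vacPoly w o.2).sum

/-- The tensor word `b₁ ⊗ ⋯ ⊗ bₘ`. -/
def wordTensor (bs : List (List (I ⊕ J))) : TensorAlgebra ℂ (List (I ⊕ J) →₀ ℂ) :=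
  (bs.map fun b => TensorAlgebra.ι ℂ (Finsupp.single b 1)).prod

theorem vac_wordTensor (bs : List (List (I ⊕ J))) :
    vac _ (wordTensor bs) = if bs = [] then 1 else 0 := by
  cases bs <;> simp [wordTensor, vac_one, vac_mul, vac_ι]

theorem faceOp_wordTensor (κ : List (I ⊕ J) → ℂ) (k : I ⊕ J) (bs : List (List (I ⊕ J))) :
    faceOp (wordData κ) k (wordTensor bs) =
      ((terms k bs).map fun o => MvPolynomial.eval κ o.1 • wordTensor o.2).sum := by
  rcases k with i | j
  · change (wordData κ (Sum.inl i)).left _ = ((leftTerms _ _).map _).sum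
    rcases bs with _ | ⟨b, bs⟩
    · simp [wordTensor, OpData.left_one, OpData.new, wordData, leftTerms,
        Algebra.algebraMap_eq_smul_one]
    · simp only [wordTensor, List.map_cons, List.prod_cons, OpData.left_ι_mul]
      simp [OpData.new, OpData.modify, wordData, leftTerms,
        Algebra.algebraMap_eq_smul_one, add_mul, Finsupp.lmapDomain_apply,
        Finsupp.mapDomain_single]
      abel
  · change (wordData κ (Sum.inr j)).right _ = (((leftTerms _ _).map _).map _).sum
    -- Reversal turns the rightmost factor into the head of `cs`, as in `terms`.
    obtain ⟨cs, rfl⟩ : ∃ cs, bs = List.reverse cs := ⟨bs.reverse, by simp⟩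
    rcases cs with _ | ⟨b, bs⟩
    · simp [wordTensor, OpData.right_one, OpData.new, wordData, leftTerms,
        Algebra.algebraMap_eq_smul_one]
    · simp only [wordTensor, List.reverse_cons, List.map_append, List.prod_append, List.map_cons,
        List.map_nil, List.prod_cons, List.prod_nil, mul_one, OpData.right_mul_ι]
      simp [OpData.new, OpData.modify, wordData, leftTerms,
        Algebra.algebraMap_eq_smul_one, mul_add, Finsupp.lmapDomain_apply,
        Finsupp.mapDomain_single, mul_assoc]
      abel

/-- The last variable of a monomial acts first, hence the reversal of `w`. -/
theorem vac_lift_wordTensor (κ : List (I ⊕ J) → ℂ) (w : List (I ⊕ J))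
    (bs : List (List (I ⊕ J))) :
    vac _ (FreeAlgebra.lift ℂ (faceOp (wordData κ)) (monomial w.reverse) (wordTensor bs)) =
      MvPolynomial.eval κ (vacPoly w bs) := by
  induction w generalizing bs with
  | nil =>
    rw [List.reverse_nil, monomial_nil, map_one, Module.End.one_apply, vac_wordTensor, vacPoly]
    split_ifs <;> simp
  | cons k w ih =>
    rw [List.reverse_cons, monomial_append, map_mul, Module.End.mul_apply, vacPoly,
      monomial_cons k, monomial_nil, mul_one]
    simp only [FreeAlgebra.lift_ι_apply, faceOp_wordTensor, map_list_sum, List.map_map]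
    refine congrArg List.sum (List.map_congr_left fun o _ => ?_)
    simp [ih o.2]

/-- The moment of the word `α` as a polynomial in the cumulants. -/
def momentPoly (α : List (I ⊕ J)) : MvPolynomial (List (I ⊕ J)) ℂ := vacPoly α.reverse []

theorem cumDist_monomial (κ : List (I ⊕ J) → ℂ) (α : List (I ⊕ J)) :
    cumDist κ (monomial α) = MvPolynomial.eval κ (momentPoly α) := by
  have := vac_lift_wordTensor κ α.reverse []
  rw [List.reverse_reverse] at this
  exact this

/-- Each action adds one position, which ends up in an unfinished letter or in the cumulant just
emitted. -/
theorem terms_weight (k : I ⊕ J) (bs : List (List (I ⊕ J))) :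
    ∀ o ∈ terms k bs, ∃ m, o.1.IsWeightedHomogeneous List.length m ∧
      m + (o.2.map List.length).sum = 1 + (bs.map List.length).sum := by
  have h1 : (1 : MvPolynomial (List (I ⊕ J)) ℂ).IsWeightedHomogeneous List.length 0 :=
    MvPolynomial.isWeightedHomogeneous_one _ _
  have hX : ∀ v : List (I ⊕ J), (MvPolynomial.X v : MvPolynomial _ ℂ).IsWeightedHomogeneous
      List.length v.length := fun v => MvPolynomial.isWeightedHomogeneous_X _ _ _
  have hl : ∀ bs : List (List (I ⊕ J)), ∀ o ∈ leftTerms k bs,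
      ∃ m, o.1.IsWeightedHomogeneous List.length m ∧
        m + (o.2.map List.length).sum = 1 + (bs.map List.length).sum := by
    rintro (_ | ⟨b, bs⟩) o ho
    · simp only [leftTerms, List.mem_cons, List.not_mem_nil, or_false] at ho
      rcases ho with rfl | rfl
      exacts [⟨_, h1, by simp⟩, ⟨_, hX _, by simp⟩]
    · simp only [leftTerms, List.mem_cons, List.not_mem_nil, or_false] at ho
      rcases ho with rfl | rfl | rfl | rfl
      exacts [⟨_, h1, by simp⟩, ⟨_, hX _, by simp⟩, ⟨_, h1, by simp; omega⟩,
        ⟨_, hX _, by simp; omega⟩]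
  rcases k with i | j
  · exact hl bs
  · intro o ho
    obtain ⟨o', ho', rfl⟩ := List.mem_map.1 ho
    obtain ⟨m, hm, h⟩ := hl _ o' ho'
    exact ⟨m, hm, by simpa using h⟩

theorem vacPoly_weight (w : List (I ⊕ J)) (bs : List (List (I ⊕ J))) :
    (vacPoly w bs).IsWeightedHomogeneous List.length (w.length + (bs.map List.length).sum) := by
  induction w generalizing bs with
  | nil =>
    rw [vacPoly]
    split_ifs with h
    · subst h; exact MvPolynomial.isWeightedHomogeneous_one _ _
    · exact MvPolynomial.isWeightedHomogeneous_zero _ _ _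
  | cons k w ih =>
    rw [vacPoly, ← MvPolynomial.mem_weightedHomogeneousSubmodule]
    refine list_sum_mem fun p hp => ?_
    obtain ⟨o, ho, rfl⟩ := List.mem_map.1 hp
    obtain ⟨m, hm, h⟩ := terms_weight k bs o ho
    rw [MvPolynomial.mem_weightedHomogeneousSubmodule]
    convert hm.mul (ih o.2) using 1
    simp only [List.length_cons]; omega

/-- The words which occur as cumulants in `vacPoly w bs`. -/
def accessible (w : List (I ⊕ J)) (bs : List (List (I ⊕ J))) : Set (List (I ⊕ J)) :=
  {v | v ≠ [] ∧ (v.Sublist w.reverse ∨ ∃ b ∈ bs, v.Sublist (w.reverse ++ b))}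

theorem terms_mem (k : I ⊕ J) (bs : List (List (I ⊕ J))) :
    ∀ o ∈ terms k bs, (o.1 = 1 ∨ o.1 = MvPolynomial.X [k] ∨
        ∃ b ∈ bs, o.1 = MvPolynomial.X (k :: b)) ∧
      ∀ c ∈ o.2, c ∈ bs ∨ c = [k] ∨ ∃ b ∈ bs, c = k :: b := by
  have hl : ∀ bs : List (List (I ⊕ J)), ∀ o ∈ leftTerms k bs, (o.1 = 1 ∨
      o.1 = MvPolynomial.X [k] ∨ ∃ b ∈ bs, o.1 = MvPolynomial.X (k :: b)) ∧
      ∀ c ∈ o.2, c ∈ bs ∨ c = [k] ∨ ∃ b ∈ bs, c = k :: b := by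
    rintro (_ | ⟨b, bs⟩) o ho
    · simp only [leftTerms, List.mem_cons, List.not_mem_nil, or_false] at ho
      rcases ho with rfl | rfl <;> simp
    · simp only [leftTerms, List.mem_cons, List.not_mem_nil, or_false] at ho
      rcases ho with rfl | rfl | rfl | rfl <;> simp +contextual
  rcases k with i | j
  · exact hl bs
  · intro o ho
    obtain ⟨o', ho', rfl⟩ := List.mem_map.1 ho
    simpa using hl _ o' ho'

/-- A letter grows only by positions further to the left, so an emitted cumulant is a subword of the
remaining positions, followed possibly by one letter already present. -/
theorem vacPoly_mem_supported (w : List (I ⊕ J)) (bs : List (List (I ⊕ J))) :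
    vacPoly w bs ∈ MvPolynomial.supported ℂ (accessible w bs) := by
  induction w generalizing bs with
  | nil =>
    rw [vacPoly]
    split_ifs
    exacts [one_mem _, zero_mem _]
  | cons k w ih =>
    rw [vacPoly]
    refine list_sum_mem fun p hp => ?_
    obtain ⟨o, ho, rfl⟩ := List.mem_map.1 hp
    obtain ⟨h1, h2⟩ := terms_mem k bs o ho
    refine mul_mem ?_ (MvPolynomial.supported_mono ?_ (ih o.2))
    · rcases h1 with h | h | ⟨b, hb, h⟩ <;> rw [h]
      · exact one_mem _
      · exact MvPolynomial.X_mem_supported.2 ⟨by simp, Or.inl (by simp)⟩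
      · exact MvPolynomial.X_mem_supported.2 ⟨by simp, Or.inr ⟨b, hb, by simp⟩⟩
    · rintro v ⟨hv, h⟩
      refine ⟨hv, ?_⟩
      rw [List.reverse_cons]
      rcases h with h | ⟨c, hc, h⟩
      · exact Or.inl (h.trans (by simp))
      · rcases h2 c hc with h' | rfl | ⟨b, hb, rfl⟩
        · exact Or.inr ⟨c, h', h.trans (by simp)⟩
        · exact Or.inl h
        · exact Or.inr ⟨b, hb, by simpa using h⟩

/-- The polynomials in cumulants of order less than `n`. -/
def lowOrder (I J : Type u) (n : ℕ) : Subalgebra ℂ (MvPolynomial (List (I ⊕ J)) ℂ) :=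
  MvPolynomial.supported ℂ {v | v.length < n}

theorem X_mem_lowOrder {n : ℕ} {v : List (I ⊕ J)} (h : v.length < n) :
    MvPolynomial.X v ∈ lowOrder I J n := MvPolynomial.X_mem_supported.2 h

theorem vacPoly_mem_lowOrder {n : ℕ} (w : List (I ⊕ J)) (bs : List (List (I ⊕ J)))
    (h : w.length + (bs.map List.length).sum < n) : vacPoly w bs ∈ lowOrder I J n := by
  refine MvPolynomial.supported_mono ?_ (vacPoly_mem_supported w bs)
  rintro v ⟨-, hv | ⟨b, hb, hv⟩⟩
  · have := hv.length_le
    rw [List.length_reverse] at this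
    simp only [Set.mem_ofPred_eq]; omega
  · have h1 := hv.length_le
    have h2 := List.single_le_sum (by simp) _ (List.mem_map_of_mem (f := List.length) hb)
    simp only [List.length_append, List.length_reverse] at h1
    simp only [Set.mem_ofPred_eq]; omega

theorem terms_of_two_le (k : I ⊕ J) (bs : List (List (I ⊕ J))) (h2 : 2 ≤ bs.length)
    (hbs : ∀ b ∈ bs, b ≠ []) : ∀ o ∈ terms k bs,
      (o.1 = 1 ∧ 2 ≤ o.2.length ∧ (∀ b ∈ o.2, b ≠ []) ∧
        (o.2.map List.length).sum = 1 + (bs.map List.length).sum) ∨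
      ∃ u, o.1 = MvPolynomial.X u ∧ u.length < 1 + (bs.map List.length).sum ∧
        (o.2.map List.length).sum < 1 + (bs.map List.length).sum := by
  have hl : ∀ bs : List (List (I ⊕ J)), 2 ≤ bs.length → (∀ b ∈ bs, b ≠ []) →
      ∀ o ∈ leftTerms k bs, (o.1 = 1 ∧ 2 ≤ o.2.length ∧ (∀ b ∈ o.2, b ≠ []) ∧
        (o.2.map List.length).sum = 1 + (bs.map List.length).sum) ∨
      ∃ u, o.1 = MvPolynomial.X u ∧ u.length < 1 + (bs.map List.length).sum ∧
        (o.2.map List.length).sum < 1 + (bs.map List.length).sum := by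
    rintro (_ | ⟨b, _ | ⟨b', bs⟩⟩) h2 hbs o ho
    · simp at h2
    · simp at h2
    · have hb : 0 < b.length := List.length_pos_iff.2 (hbs b (by simp))
      have hb' : 0 < b'.length := List.length_pos_iff.2 (hbs b' (by simp))
      have hbs' : ∀ a ∈ bs, a ≠ [] := fun a ha => hbs a (by simp [ha])
      simp only [leftTerms, List.mem_cons, List.not_mem_nil, or_false] at ho
      rcases ho with rfl | rfl | rfl | rfl
      · left; simp only [List.mem_cons, List.map_cons, List.sum_cons, List.length_cons]
        refine ⟨trivial, by omega, ?_, by simp⟩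
        rintro a (rfl | rfl | rfl | ha)
        exacts [by simp, hbs _ (by simp), hbs _ (by simp), hbs' a ha]
      · right; exact ⟨_, rfl, by simp; omega, by simp⟩
      · left; simp only [List.mem_cons, List.map_cons, List.sum_cons, List.length_cons]
        refine ⟨trivial, by omega, ?_, by omega⟩
        rintro a (rfl | rfl | ha)
        exacts [by simp, hbs _ (by simp), hbs' a ha]
      · right; exact ⟨_, rfl, by simp; omega, by simp; omega⟩
  rcases k with i | j
  · exact hl bs h2 hbs
  · intro o ho
    obtain ⟨o', ho', rfl⟩ := List.mem_map.1 ho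
    simpa using hl bs.reverse (by simpa using h2) (by simpa using hbs) o' ho'

/-- Two unfinished letters are never merged, so no single cumulant can absorb all positions. -/
theorem vacPoly_of_two_le (w : List (I ⊕ J)) (bs : List (List (I ⊕ J))) (h2 : 2 ≤ bs.length)
    (hbs : ∀ b ∈ bs, b ≠ []) :
    vacPoly w bs ∈ lowOrder I J (w.length + (bs.map List.length).sum) := by
  induction w generalizing bs with
  | nil =>
    rw [vacPoly]
    split_ifs
    exacts [one_mem _, zero_mem _]
  | cons k w ih =>
    rw [vacPoly]
    refine list_sum_mem fun p hp => ?_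
    obtain ⟨o, ho, rfl⟩ := List.mem_map.1 hp
    -- Until a cumulant is emitted, two letters persist and induction applies. Once one is emitted,
    -- both it and the weight left over lie below the total.
    rcases terms_of_two_le k bs h2 hbs o ho with ⟨h, h', h'', hs⟩ | ⟨u, h, hu, hs⟩
    · have := ih o.2 h' h''
      rw [h, one_mul]
      convert this using 1
      rw [hs, List.length_cons]; congr 1; omega
    · rw [h]
      exact mul_mem (X_mem_lowOrder (by rw [List.length_cons]; omega))
        (vacPoly_mem_lowOrder _ _ (by rw [List.length_cons]; omega))

theorem vacPoly_cons_nil (k : I ⊕ J) (w : List (I ⊕ J)) :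
    vacPoly (k :: w) [] = vacPoly w [[k]] + MvPolynomial.X [k] * vacPoly w [] := by
  rw [vacPoly]
  cases k <;> simp [terms, leftTerms]

theorem vacPoly_cons_singleton (k : I ⊕ J) (w b : List (I ⊕ J)) :
    ∃ bs ∈ [[[k], b], [b, [k]]], vacPoly (k :: w) [b] = vacPoly w bs +
      MvPolynomial.X [k] * vacPoly w [b] + vacPoly w [k :: b] +
      MvPolynomial.X (k :: b) * vacPoly w [] := by
  rw [vacPoly]
  rcases k with i | j
  · exact ⟨[[Sum.inl i], b], by simp, by simp [terms, leftTerms]; ring⟩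
  · exact ⟨[b, [Sum.inr j]], by simp, by simp [terms, leftTerms]; ring⟩

/-- The top cumulant arises in one way only: every variable but the last prolongs `b`, and the last
one closes it. Opening a second letter, splitting off a singleton or closing early gives lower
order. -/
theorem vacPoly_singleton_sub_X_mem (w b : List (I ⊕ J)) (hw : w ≠ []) (hb : b ≠ []) :
    vacPoly w [b] - MvPolynomial.X (w.reverse ++ b) ∈ lowOrder I J (w.length + b.length) := by
  induction w generalizing b with
  | nil => exact absurd rfl hw
  | cons k w ih =>
    have hb' : 0 < b.length := List.length_pos_iff.2 hb
    obtain ⟨bs, hbs, h⟩ := vacPoly_cons_singleton k w b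
    have h1 : vacPoly w bs ∈ lowOrder I J ((k :: w).length + b.length) := by
      simp only [List.mem_cons, List.not_mem_nil, or_false] at hbs
      rcases hbs with rfl | rfl
      · convert vacPoly_of_two_le w [[k], b] (by simp) (by simp [hb]) using 1
        simp; congr 1; omega
      · convert vacPoly_of_two_le w [b, [k]] (by simp) (by simp [hb]) using 1
        simp; congr 1; omega
    have h2 : MvPolynomial.X [k] * vacPoly w [b] ∈ lowOrder I J ((k :: w).length + b.length) :=
      mul_mem (X_mem_lowOrder (by simp; omega)) (vacPoly_mem_lowOrder _ _ (by simp))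
    rw [h]
    -- For `w = []` the closing term is the leading one, and prolonging contributes zero because a
    -- letter remains.
    rcases eq_or_ne w [] with rfl | hw
    · convert add_mem h1 h2 using 1
      simp [vacPoly]
    · have h3 := ih (k :: b) hw (by simp)
      rw [show w.length + (k :: b).length = (k :: w).length + b.length by simp; omega] at h3
      have hw' := List.length_pos_iff.2 hw
      have h4 : MvPolynomial.X (k :: b) * vacPoly w [] ∈
          lowOrder I J ((k :: w).length + b.length) :=
        mul_mem (X_mem_lowOrder (by simp; omega)) (vacPoly_mem_lowOrder _ _ (by simp; omega))
      convert add_mem (add_mem h1 h2) (add_mem h3 h4) using 1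
      simp only [List.reverse_cons, List.append_assoc, List.singleton_append]
      ring

theorem vacPoly_nil_sub_X_mem (w : List (I ⊕ J)) (hw : w ≠ []) :
    vacPoly w [] - MvPolynomial.X w.reverse ∈ lowOrder I J w.length := by
  rcases w with _ | ⟨k, w⟩
  · exact absurd rfl hw
  rw [vacPoly_cons_nil]
  rcases eq_or_ne w [] with rfl | hw
  · simp [vacPoly]
  · have hw' := List.length_pos_iff.2 hw
    have h1 : vacPoly w [[k]] - MvPolynomial.X (w.reverse ++ [k]) ∈
        lowOrder I J (k :: w).length := vacPoly_singleton_sub_X_mem w [k] hw (by simp)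
    have h2 : MvPolynomial.X [k] * vacPoly w [] ∈ lowOrder I J (k :: w).length :=
      mul_mem (X_mem_lowOrder (by simp; omega)) (vacPoly_mem_lowOrder _ _ (by simp))
    convert add_mem h1 h2 using 1
    rw [List.reverse_cons]
    ring

/-- The part of the moment-cumulant formula which involves cumulants of lower order. -/
def momentRest (α : List (I ⊕ J)) : MvPolynomial (List (I ⊕ J)) ℂ :=
  momentPoly α - MvPolynomial.X α

theorem momentPoly_weight (α : List (I ⊕ J)) :
    (momentPoly α).IsWeightedHomogeneous List.length α.length := by
  simpa [momentPoly] using vacPoly_weight α.reverse []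

theorem momentRest_weight (α : List (I ⊕ J)) :
    (momentRest α).IsWeightedHomogeneous List.length α.length := by
  rw [← MvPolynomial.mem_weightedHomogeneousSubmodule]
  exact sub_mem (momentPoly_weight α) (MvPolynomial.isWeightedHomogeneous_X _ _ _)

/-- Two estimates are combined: the order bound makes the recursion for `cumPoly` terminate, and
accessibility gives the subword property. -/
theorem momentRest_vars {α : List (I ⊕ J)} (hα : α ≠ []) :
    ∀ v ∈ (momentRest α).vars, v ≠ [] ∧ v.length < α.length ∧ v.Sublist α := by
  intro v hv
  have h1 : momentRest α ∈ lowOrder I J α.length := by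
    simpa [momentRest, momentPoly] using vacPoly_nil_sub_X_mem α.reverse (by simpa using hα)
  have h2 : momentRest α ∈ MvPolynomial.supported ℂ (accessible α.reverse []) :=
    sub_mem (vacPoly_mem_supported _ _)
      (MvPolynomial.X_mem_supported.2 ⟨hα, Or.inl (by simp)⟩)
  obtain ⟨h3, h4⟩ := MvPolynomial.mem_supported.1 h2 hv
  exact ⟨h3, MvPolynomial.mem_supported.1 h1 hv, by simpa using h4⟩

end Canonical

/-! ### The bi-free cumulants -/

/-! ### Substitution into weighted homogeneous polynomials -/

section Substitution

variable {σ : Type u} {τ : Type v}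

theorem aeval_mem_of_vars {A : Type w} [CommRing A] [Algebra ℂ A] (S : Subalgebra ℂ A)
    (p : MvPolynomial σ ℂ) (g : σ → A) (h : ∀ i ∈ p.vars, g i ∈ S) :
    MvPolynomial.aeval g p ∈ S := by
  rw [MvPolynomial.aeval_def, MvPolynomial.eval₂_eq]
  exact sum_mem fun d hd => mul_mem (S.algebraMap_mem _) <| prod_mem fun i hi =>
    pow_mem (h i ((MvPolynomial.mem_vars_iff_mem_support i).2 ⟨d, hd, hi⟩)) _

theorem weight_of_mem_support {wσ : σ → ℕ} {n : ℕ} {p : MvPolynomial σ ℂ}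
    (hp : p.IsWeightedHomogeneous wσ n) {d : σ →₀ ℕ} (hd : d ∈ p.support) :
    ∑ i ∈ d.support, d i * wσ i = n := by
  have := hp (MvPolynomial.mem_support_iff.1 hd)
  simpa [Finsupp.weight_apply, Finsupp.sum] using this

theorem aeval_weight {wσ : σ → ℕ} {wτ : τ → ℕ} {n : ℕ} {p : MvPolynomial σ ℂ}
    (hp : p.IsWeightedHomogeneous wσ n) {g : σ → MvPolynomial τ ℂ}
    (h : ∀ i ∈ p.vars, (g i).IsWeightedHomogeneous wτ (wσ i)) :
    (MvPolynomial.aeval g p).IsWeightedHomogeneous wτ n := by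
  rw [MvPolynomial.aeval_def, MvPolynomial.eval₂_eq]
  refine MvPolynomial.IsWeightedHomogeneous.sum _ _ _ fun d hd => ?_
  rw [← weight_of_mem_support hp hd]
  refine MvPolynomial.IsWeightedHomogeneous.C_mul ?_ _
  refine MvPolynomial.IsWeightedHomogeneous.prod _ _ _ fun i hi => ?_
  exact (h i (MvPolynomial.mem_vars_iff_mem_support i |>.2 ⟨d, hd, hi⟩)).pow _

/-- A weighted homogeneous polynomial without linear terms has a double zero along a curve on which
all its variables vanish at `0`. -/
theorem X_sq_dvd_aeval {wσ : σ → ℕ} {n : ℕ} {p : MvPolynomial σ ℂ}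
    (hp : p.IsWeightedHomogeneous wσ n) (hn : n ≠ 0) (hv : ∀ i ∈ p.vars, wσ i < n)
    (g : σ → Polynomial ℂ) (hg : ∀ i ∈ p.vars, Polynomial.X ∣ g i) :
    Polynomial.X ^ 2 ∣ MvPolynomial.aeval g p := by
  rw [MvPolynomial.aeval_def, MvPolynomial.eval₂_eq]
  refine Finset.dvd_sum fun d hd => Dvd.dvd.mul_left ?_ _
  have hmem : ∀ i ∈ d.support, i ∈ p.vars := fun i hi => MvPolynomial.mem_vars_iff_mem_support i |>.2 ⟨d, hd, hi⟩
  have h1 : ∏ i ∈ d.support, (Polynomial.X : Polynomial ℂ) ^ d i ∣ ∏ i ∈ d.support, g i ^ d i :=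
    Finset.prod_dvd_prod_of_dvd _ _ fun i hi => pow_dvd_pow_of_dvd (hg i (hmem i hi)) _
  rw [Finset.prod_pow_eq_pow_sum] at h1
  refine (pow_dvd_pow _ ?_).trans h1
  -- At most one factor, of weight at most `n - 1`, cannot reach the total weight `n`.
  by_contra! hlt
  have h2 := weight_of_mem_support hp hd
  have h3 : ∑ i ∈ d.support, d i * wσ i ≤ ∑ i ∈ d.support, d i * (n - 1) :=
    Finset.sum_le_sum fun i hi => Nat.mul_le_mul_left _ (by have := hv i (hmem i hi); omega)
  rw [← Finset.sum_mul, h2] at h3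
  have h4 : (∑ i ∈ d.support, d i) * (n - 1) ≤ 1 * (n - 1) := Nat.mul_le_mul_right _ (by omega)
  omega

theorem eval_aeval (μ : τ → ℂ) (g : σ → MvPolynomial τ ℂ) (p : MvPolynomial σ ℂ) :
    MvPolynomial.eval μ (MvPolynomial.aeval g p) =
      MvPolynomial.eval (fun i => MvPolynomial.eval μ (g i)) p := by
  have : (MvPolynomial.eval μ).comp (MvPolynomial.aeval g : _ →ₐ[ℂ] _).toRingHom =
      MvPolynomial.eval (fun i => MvPolynomial.eval μ (g i)) :=
    MvPolynomial.ringHom_ext (by simp) (by simp)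
  exact RingHom.congr_fun this p

theorem eval_congr_vars {f g : σ → ℂ} {p : MvPolynomial σ ℂ} (h : ∀ i ∈ p.vars, f i = g i) :
    MvPolynomial.eval f p = MvPolynomial.eval g p :=
  MvPolynomial.eval₂Hom_congr' rfl (fun i hi _ => h i hi) rfl

end Substitution

/-! ### Existence, additivity and uniqueness of cumulants -/

section Cumulants

variable {I J : Type u}

/-- The bi-free cumulant polynomial of the word `α`. -/
def cumPoly (α : List (I ⊕ J)) : MvPolynomial (List (I ⊕ J)) ℂ :=
  MvPolynomial.X α - MvPolynomial.aeval
    -- The guard only serves termination: for nonempty `α` it holds on every variable of `momentRest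
    -- α`.
    (fun β => if _ : β.length < α.length then cumPoly β else 0) (momentRest α)
termination_by α.length

theorem cumPoly_eq {α : List (I ⊕ J)} (hα : α ≠ []) :
    cumPoly α = MvPolynomial.X α - MvPolynomial.aeval cumPoly (momentRest α) := by
  rw [cumPoly]
  congr 1
  refine MvPolynomial.eval₂Hom_congr' rfl (fun v hv _ => ?_) rfl
  exact dif_pos (momentRest_vars hα v hv).2.1

theorem cumPoly_vars {α : List (I ⊕ J)} (hα : α ≠ []) :
    ∀ v ∈ (cumPoly α - MvPolynomial.X α).vars,
      v ≠ [] ∧ v.length < α.length ∧ v.Sublist α := by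
  suffices h : cumPoly α - MvPolynomial.X α ∈ MvPolynomial.supported ℂ
      {v | v ≠ [] ∧ v.length < α.length ∧ v.Sublist α} from fun v hv =>
    MvPolynomial.mem_supported.1 h hv
  induction hn : α.length using Nat.strong_induction_on generalizing α with
  | _ n ih =>
  subst hn
  rw [cumPoly_eq hα, sub_sub_cancel_left]
  refine neg_mem (aeval_mem_of_vars _ _ _ fun v hv => ?_)
  obtain ⟨h1, h2, h3⟩ := momentRest_vars hα v hv
  rw [← sub_add_cancel (cumPoly v) (MvPolynomial.X v)]
  refine add_mem (MvPolynomial.supported_mono ?_ (ih _ h2 h1 rfl))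
    (MvPolynomial.X_mem_supported.2 ⟨h1, h2, h3⟩)
  rintro β ⟨h4, h5, h6⟩
  exact ⟨h4, h5.trans h2, h6.trans h3⟩

theorem cumPoly_weight {α : List (I ⊕ J)} (hα : α ≠ []) :
    (cumPoly α).IsWeightedHomogeneous List.length α.length := by
  induction hn : α.length using Nat.strong_induction_on generalizing α with
  | _ n ih =>
  subst hn
  rw [cumPoly_eq hα]
  refine (MvPolynomial.isWeightedHomogeneous_X _ _ _).sub
    (aeval_weight (momentRest_weight α) fun v hv => ?_)
  obtain ⟨h1, h2, h3⟩ := momentRest_vars hα v hv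
  exact ih _ h2 h1 rfl

theorem cumDist_one (κ : List (I ⊕ J) → ℂ) : cumDist κ 1 = 1 := vacDist_one _

theorem cumDist_monomial_eq (κ : List (I ⊕ J) → ℂ) (α : List (I ⊕ J)) :
    cumDist κ (monomial α) = κ α + MvPolynomial.eval κ (momentRest α) := by
  simp [cumDist_monomial, momentRest]

theorem evalMoments_cumPoly (μ : FreeAlgebra ℂ (I ⊕ J) →ₗ[ℂ] ℂ) {α : List (I ⊕ J)}
    (hα : α ≠ []) : evalMoments μ (cumPoly α) =
      μ (monomial α) - MvPolynomial.eval (fun β => evalMoments μ (cumPoly β)) (momentRest α) := by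
  rw [cumPoly_eq hα]
  simp only [evalMoments, map_sub, MvPolynomial.eval_X, eval_aeval]

/-- The recursion for `cumPoly` is the moment formula of the model solved for its leading term. -/
theorem evalMoments_cumDist_cumPoly (κ : List (I ⊕ J) → ℂ) {α : List (I ⊕ J)} (hα : α ≠ []) :
    evalMoments (cumDist κ) (cumPoly α) = κ α := by
  induction hn : α.length using Nat.strong_induction_on generalizing α with
  | _ n ih =>
  subst hn
  have h : ∀ v ∈ (momentRest α).vars, evalMoments (cumDist κ) (cumPoly v) = κ v := fun v hv => by
    obtain ⟨h1, h2, -⟩ := momentRest_vars hα v hv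
    exact ih _ h2 h1 rfl
  rw [evalMoments_cumPoly _ hα, cumDist_monomial_eq, eval_congr_vars h, add_sub_cancel_right]

/-- Every distribution is determined by its cumulants. -/
theorem eq_cumDist {μ : FreeAlgebra ℂ (I ⊕ J) →ₗ[ℂ] ℂ} (h : μ 1 = 1) :
    μ = cumDist fun α => evalMoments μ (cumPoly α) := by
  refine functional_ext fun α => ?_
  rcases eq_or_ne α [] with rfl | hα
  · rw [monomial_nil, h, cumDist_one]
  · rw [cumDist_monomial_eq, evalMoments_cumPoly _ hα, sub_add_cancel]

theorem distribution_apply_one {κ : Type u} {A : Type v} [Ring A] [Algebra ℂ A] (φ : A →ₗ[ℂ] ℂ)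
    (z : κ → A) : distribution φ z 1 = φ 1 := by simp [distribution]

theorem isBiFreeCumulantPolynomial_cumPoly {α : List (I ⊕ J)} (hα : α ≠ []) :
    IsBiFreeCumulantPolynomial α (cumPoly α) where
  leading v hv := by
    obtain ⟨h1, h2, h3⟩ := cumPoly_vars hα v hv
    exact ⟨h1, fun h => by simp [h] at h2, h3⟩
  homogeneous := cumPoly_weight hα
  additive A _ _ φ hφ z' z'' hz := by
    obtain ⟨X, S, h⟩ := hz
    -- The marginals are taken on the spaces `X t`; that `z'` and `z''` have the same ones comes out
    -- in `h1`.
    let μ : Bool → FreeAlgebra ℂ (I ⊕ J) →ₗ[ℂ] ℂ := fun t =>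
      distribution (X t).expectation (S t)
    have hμ : ∀ t, μ t 1 = 1 := fun t => (distribution_apply_one _ _).trans (X t).ψ_ξ
    let κ : Bool → List (I ⊕ J) → ℂ := fun t α => evalMoments (μ t) (cumPoly α)
    have hκ : ∀ t, μ t = cumDist (κ t) := fun t => eq_cumDist (hμ t)
    have h' := h.trans (distribution_biFreeOp_eq (d := fun t => wordData (κ t)) hκ)
    have h1 : ∀ t, distribution φ (cond t z'' z') = cumDist (κ t) := fun t => by
      have := distribution_lift_congr h' fun k => FreeAlgebra.ι ℂ (t, k)
      simp only [FreeAlgebra.lift_ι_apply] at this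
      exact this.trans (distribution_colorOp _ t)
    have h2 : distribution φ (z' + z'') = cumDist (κ false + κ true) := by
      have := distribution_lift_congr h' fun k =>
        FreeAlgebra.ι ℂ (false, k) + FreeAlgebra.ι ℂ (true, k)
      simp only [FreeAlgebra.lift_ι_apply, map_add] at this
      exact this.trans (cumDist_add κ)
    have h3 : distribution φ z' = cumDist (κ false) := h1 false
    have h4 : distribution φ z'' = cumDist (κ true) := h1 true
    rw [h2, h3, h4]
    simp only [evalMoments_cumDist_cumPoly _ hα, Pi.add_apply]

/-- The additivity axiom is applied to the coloured pair, whose cumulants can be chosen at will. -/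
theorem IsBiFreeCumulantPolynomial.cumDist_add {α : List (I ⊕ J)}
    {R : MvPolynomial (List (I ⊕ J)) ℂ} (hR : IsBiFreeCumulantPolynomial α R)
    (κ κ' : List (I ⊕ J) → ℂ) :
    evalMoments (cumDist κ) R + evalMoments (cumDist κ') R =
      evalMoments (cumDist (κ + κ')) R := by
  let c : Bool → List (I ⊕ J) → ℂ := fun t => cond t κ' κ
  let d : Bool → I ⊕ J → OpData (List (I ⊕ J) →₀ ℂ) := fun t => wordData (c t)
  have h := hR.additive (Module.End ℂ (TensorAlgebra ℂ (Bool → (List (I ⊕ J) →₀ ℂ))))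
    (vecState (vac _) 1) (by simp [vecState_apply, vac_one]) (fun k => colorOp d (false, k))
    (fun k => colorOp d (true, k)) (by
      convert isBiFree_colorOp d using 2 with t
      cases t <;> rfl)
  rw [distribution_colorOp, distribution_colorOp] at h
  exact h.trans (congrArg (evalMoments · R) (BiFree.cumDist_add c))

/-- All cumulant polynomials of a word take the same values. -/
theorem IsBiFreeCumulantPolynomial.evalMoments_eq {α : List (I ⊕ J)} (hα : α ≠ [])
    {R : MvPolynomial (List (I ⊕ J)) ℂ} (hR : IsBiFreeCumulantPolynomial α R)
    {μ : FreeAlgebra ℂ (I ⊕ J) →ₗ[ℂ] ℂ} (hμ : μ 1 = 1) :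
    evalMoments μ R = evalMoments μ (cumPoly α) := by
  have hC := isBiFreeCumulantPolynomial_cumPoly hα
  -- The leading variables cancel, so `Q` involves only shorter words and, being homogeneous, has no
  -- linear term.
  set Q := R - cumPoly α with hQ
  have hw : Q.IsWeightedHomogeneous List.length α.length := hR.homogeneous.sub hC.homogeneous
  have hv : ∀ v ∈ Q.vars, v ≠ [] ∧ v.length < α.length := by
    suffices h : Q ∈ MvPolynomial.supported ℂ {v | v ≠ [] ∧ v.length < α.length} from
      fun v hv => MvPolynomial.mem_supported.1 h hv
    rw [hQ, ← sub_sub_sub_cancel_right R (cumPoly α) (MvPolynomial.X α)]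
    refine sub_mem (MvPolynomial.mem_supported.2 fun v hv => ?_)
      (MvPolynomial.mem_supported.2 fun v hv => ?_)
    · obtain ⟨h1, h2, h3⟩ := hR.leading v hv
      exact ⟨h1, lt_of_le_of_ne h3.length_le fun h => h2 (h3.eq_of_length h)⟩
    · obtain ⟨h1, h2, h3⟩ := cumPoly_vars hα v hv
      exact ⟨h1, h2⟩
  have hadd : ∀ κ κ', evalMoments (cumDist (κ + κ')) Q =
      evalMoments (cumDist κ) Q + evalMoments (cumDist κ') Q := fun κ κ' => by
    have h1 := hR.cumDist_add κ κ'
    have h2 := hC.cumDist_add κ κ'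
    simp only [evalMoments, hQ, map_sub] at h1 h2 ⊢
    rw [← h1, ← h2]; ring
  let E : (List (I ⊕ J) → ℂ) →+ ℂ := AddMonoidHom.mk' (fun κ => evalMoments (cumDist κ) Q) hadd
  suffices h : ∀ κ, E κ = 0 by
    have := h fun β => evalMoments μ (cumPoly β)
    rw [AddMonoidHom.mk'_apply, ← eq_cumDist hμ] at this
    simpa [evalMoments, hQ, sub_eq_zero] using this
  intro κ
  -- The moments along the curve `cumDist (s • κ)`, as polynomials in `s`.
  let g : List (I ⊕ J) → Polynomial ℂ := fun β =>
    MvPolynomial.aeval (fun v => Polynomial.C (κ v) * Polynomial.X) (momentPoly β)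
  have hg : ∀ β (s : ℂ), (g β).eval s = cumDist (s • κ) (monomial β) := fun β s => by
    rw [cumDist_monomial]
    have : (Polynomial.evalRingHom s).comp (MvPolynomial.aeval
        (fun v => Polynomial.C (κ v) * Polynomial.X) : _ →ₐ[ℂ] Polynomial ℂ).toRingHom =
        MvPolynomial.eval (s • κ) :=
      MvPolynomial.ringHom_ext (fun r => by simp) (fun v => by simp; exact mul_comm _ _)
    exact RingHom.congr_fun this _
  have hE : ∀ s : ℂ, (MvPolynomial.aeval g Q).eval s = E (s • κ) := fun s => by
    have : (Polynomial.evalRingHom s).comp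
        (MvPolynomial.aeval g : _ →ₐ[ℂ] Polynomial ℂ).toRingHom =
        MvPolynomial.eval fun v => cumDist (s • κ) (monomial v) :=
      MvPolynomial.ringHom_ext (by simp) (by simp [hg])
    exact RingHom.congr_fun this _
  have hX : ∀ v ∈ Q.vars, Polynomial.X ∣ g v := fun v hv' => by
    rw [Polynomial.X_dvd_iff, Polynomial.coeff_zero_eq_eval_zero, hg, cumDist_monomial, zero_smul,
      MvPolynomial.eval_zero]
    -- Positive weight excludes a constant term, so the moment vanishes at `s = 0`.
    exact (momentPoly_weight v).coeff_eq_zero 0 (by simpa [eq_comm] using (hv v hv').1)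
  obtain ⟨q, hq⟩ := X_sq_dvd_aeval hw (by simpa using hα) (fun v hv' => (hv v hv').2) g hX
  -- Additivity gives `E (n • κ) = n * E κ` for natural `n` only, which suffices to identify
  -- polynomials in `s`.
  have hlin : MvPolynomial.aeval g Q = Polynomial.C (E κ) * Polynomial.X := by
    refine Polynomial.eq_of_infinite_eval_eq _ _ (Set.infinite_of_injective_forall_mem
      (f := fun n : ℕ => (n : ℂ)) Nat.cast_injective fun n => ?_)
    change Polynomial.eval (n : ℂ) _ = Polynomial.eval (n : ℂ) _
    rw [hE, Nat.cast_smul_eq_nsmul, map_nsmul]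
    rw [nsmul_eq_mul, Polynomial.eval_mul, Polynomial.eval_C, Polynomial.eval_X, mul_comm]
  -- The coefficient of `s` is `E κ` on one side and, by divisibility by the square, zero on the
  -- other.
  have h := congrArg (Polynomial.coeff · 1) (hq.symm.trans hlin)
  simp [Polynomial.coeff_X_pow_mul'] at h
  exact h.symm

end Cumulants

/-! ### The full Fock space -/

section Fock

variable {H : Type w} [NormedAddCommGroup H] [InnerProductSpace ℂ H]

theorem inner_lTensor_lTensor {E F : Type w} [NormedAddCommGroup E] [InnerProductSpace ℂ E]
    [NormedAddCommGroup F] [InnerProductSpace ℂ F] (S S' : E →ₗ[ℂ] F) (c : ℂ)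
    (hS : ∀ x y, inner ℂ (S x) (S' y) = c * inner ℂ x y) (x y : H ⊗[ℂ] E) :
    inner ℂ (LinearMap.lTensor H S x) (LinearMap.lTensor H S' y) = c * inner ℂ x y := by
  induction x using TensorProduct.induction_on with
  | zero => simp
  | add a b ha hb => simp only [map_add, inner_add_left, ha, hb, mul_add]
  | tmul a b =>
    induction y using TensorProduct.induction_on with
    | zero => simp
    | add a b ha hb => simp only [map_add, inner_add_right, ha, hb, mul_add]
    | tmul d e =>
      simp only [LinearMap.lTensor_tmul, TensorProduct.inner_tmul, hS]
      ring

theorem inner_tensorRight_tensorRight (h h' : H) (n : ℕ) (x y : Level H n) :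
    inner ℂ (tensorRight h n x) (tensorRight h' n y) = inner ℂ h h' * inner ℂ x y := by
  induction n with
  | zero => exact inner_tensorLeft h h' 0 x y
  | succ n ih => exact inner_lTensor_lTensor (tensorRight h n) (tensorRight h' n) _ ih x y

/-- `ζ ↦ h ⊗ ζ` on the space of square-summable sequences. -/
def preLeft (h : H) : PreFock H →L[ℂ] PreFock H :=
  raise (tensorLeft h) ‖h‖ fun n x => norm_eq_of_inner h x _ (inner_tensorLeft h h n x x)

/-- `ζ ↦ ζ ⊗ h` on the space of square-summable sequences. -/
def preRight (h : H) : PreFock H →L[ℂ] PreFock H :=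
  raise (tensorRight h) ‖h‖ fun n x => norm_eq_of_inner h x _ (inner_tensorRight h n x x)

variable (H) in
/-- The vacuum vector in the space of square-summable sequences. -/
def preVacuum : PreFock H := lp.single 2 0 (tensorUnit H)

theorem leftCreation_coe (h : H) (x : PreFock H) :
    leftCreation h (x : FullFock H) = (preLeft h x : PreFock H) :=
  ContinuousLinearMap.completion_apply_coe _ _

theorem rightCreation_coe (h : H) (x : PreFock H) :
    rightCreation h (x : FullFock H) = (preRight h x : PreFock H) :=
  ContinuousLinearMap.completion_apply_coe _ _

theorem preVacuum_succ (n : ℕ) : (preVacuum H : ∀ n, Level H n) (n + 1) = 0 :=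
  lp.single_apply_ne 2 0 _ (Nat.succ_ne_zero n)

/-- A creation operator shifts degrees by one and leaves degree zero empty, so the series is merely
shifted. -/
theorem inner_preFock_succ {f g : PreFock H} (hf : f 0 = 0) {f' g' : PreFock H} (c : ℂ)
    (h : ∀ n, inner ℂ (f (n + 1)) (g (n + 1)) = c * inner ℂ (f' n) (g' n)) :
    inner ℂ f g = c * inner ℂ f' g' := by
  have hs : Summable fun n => (inner ℂ (f n) (g n) : ℂ) := lp.summable_inner (𝕜 := ℂ) f g
  rw [lp.inner_eq_tsum, lp.inner_eq_tsum, hs.tsum_eq_zero_add, hf, inner_zero_left, zero_add,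
    ← tsum_mul_left]
  exact tsum_congr h

theorem inner_preLeft (h h' : H) (x y : PreFock H) :
    inner ℂ (preLeft h x) (preLeft h' y) = inner ℂ h h' * inner ℂ x y :=
  inner_preFock_succ rfl _ fun n => inner_tensorLeft h h' n (x n) (y n)

theorem inner_preRight (h h' : H) (x y : PreFock H) :
    inner ℂ (preRight h x) (preRight h' y) = inner ℂ h h' * inner ℂ x y :=
  inner_preFock_succ rfl _ fun n => inner_tensorRight_tensorRight h h' n (x n) (y n)

theorem inner_preVacuum_eq_zero {f : PreFock H} (hf : f 0 = 0) :
    inner ℂ f (preVacuum H) = 0 := by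
  rw [preVacuum, lp.inner_single_right, hf, inner_zero_left]

theorem inner_preVacuum_self : inner ℂ (preVacuum H) (preVacuum H) = 1 := by
  rw [preVacuum, lp.inner_single_right, lp.single_apply_self, inner_tensorUnit]

theorem preRight_preLeft (h h' : H) (x : PreFock H) :
    preRight h (preLeft h' x) = preLeft h' (preRight h x) := by
  ext n
  rcases n with _ | _ | n
  · rfl
  · exact (map_zero (tensorRight h 0)).trans (map_zero (tensorLeft h' 0)).symm
  · rfl

theorem preRight_preVacuum (h : H) : preRight h (preVacuum H) = preLeft h (preVacuum H) := by
  ext n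
  rcases n with _ | _ | n
  · rfl
  · rfl
  · change tensorRight h (n + 1) ((preVacuum H : ∀ n, Level H n) (n + 1)) =
      tensorLeft h (n + 1) ((preVacuum H : ∀ n, Level H n) (n + 1))
    rw [preVacuum_succ, map_zero, map_zero]

variable (H) in
/-- `preLeft` as a linear map. -/
def preLeftₗ : H →ₗ[ℂ] Module.End ℂ (PreFock H) where
  toFun h := (preLeft h).toLinearMap
  map_add' h h' := by
    ext x n
    cases n with
    | zero => exact (add_zero _).symm
    | succ n => exact TensorProduct.add_tmul h h' (x n)
  map_smul' c h := by
    ext x n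
    cases n with
    | zero => exact (smul_zero c).symm
    | succ n => exact TensorProduct.smul_tmul' c h (x n)

/-! ### The tensor algebra inside the Fock space -/

/-- The embedding `h₁ ⊗ ⋯ ⊗ hₙ ↦ h₁ ⊗ ⋯ ⊗ hₙ` of the tensor algebra. -/
def preEmbed : TensorAlgebra ℂ H →ₗ[ℂ] PreFock H :=
  LinearMap.applyₗ (preVacuum H) ∘ₗ (TensorAlgebra.lift ℂ (preLeftₗ H)).toLinearMap

theorem preEmbed_one : preEmbed (1 : TensorAlgebra ℂ H) = preVacuum H := by
  simp [preEmbed]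

theorem preEmbed_ι_mul (h : H) (η : TensorAlgebra ℂ H) :
    preEmbed (TensorAlgebra.ι ℂ h * η) = preLeft h (preEmbed η) := by
  simp [preEmbed, preLeftₗ]

/-- The embedding is built from left creation. Right creation commutes with it and agrees with it on
the vacuum. -/
theorem preEmbed_mul_ι (h : H) (η : TensorAlgebra ℂ H) :
    preEmbed (η * TensorAlgebra.ι ℂ h) = preRight h (preEmbed η) := by
  have h0 : ∀ η ζ : TensorAlgebra ℂ H,
      preEmbed (η * ζ) = TensorAlgebra.lift ℂ (preLeftₗ H) η (preEmbed ζ) := by simp [preEmbed]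
  have hc : ∀ (η : TensorAlgebra ℂ H) (x : PreFock H),
      TensorAlgebra.lift ℂ (preLeftₗ H) η (preRight h x) =
        preRight h (TensorAlgebra.lift ℂ (preLeftₗ H) η x) := by
    intro η
    induction η using TensorAlgebra.induction with
    | algebraMap r => intro x; simp
    | ι m =>
      intro x
      rw [TensorAlgebra.lift_ι_apply]
      exact (preRight_preLeft h m x).symm
    | mul a b ha hb => intro x; simp [ha, hb]
    | add a b ha hb => intro x; simp [ha, hb]
  have h1 : preEmbed (TensorAlgebra.ι ℂ h) = preRight h (preVacuum H) := by
    rw [preRight_preVacuum, ← preEmbed_one, ← preEmbed_ι_mul, mul_one]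
  rw [h0, h1, hc, ← preEmbed_one, ← h0, mul_one]

/-- The embedding of the tensor algebra into the full Fock space. -/
def fockEmbed : TensorAlgebra ℂ H →ₗ[ℂ] FullFock H :=
  (UniformSpace.Completion.toComplL (𝕜 := ℂ) (E := PreFock H)).toLinearMap ∘ₗ preEmbed

theorem fockEmbed_apply (η : TensorAlgebra ℂ H) :
    fockEmbed η = ((preEmbed η : PreFock H) : FullFock H) := rfl

theorem fockEmbed_one : fockEmbed (1 : TensorAlgebra ℂ H) = vacuum H := by
  rw [fockEmbed_apply, preEmbed_one]; rfl

theorem fockEmbed_ι_mul (h : H) (η : TensorAlgebra ℂ H) :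
    fockEmbed (TensorAlgebra.ι ℂ h * η) = leftCreation h (fockEmbed η) := by
  rw [fockEmbed_apply, preEmbed_ι_mul, fockEmbed_apply, leftCreation_coe]

theorem fockEmbed_mul_ι (h : H) (η : TensorAlgebra ℂ H) :
    fockEmbed (η * TensorAlgebra.ι ℂ h) = rightCreation h (fockEmbed η) := by
  rw [fockEmbed_apply, preEmbed_mul_ι, fockEmbed_apply, rightCreation_coe]

theorem eq_of_inner_coe {x y : FullFock H}
    (h : ∀ f : PreFock H, inner ℂ (f : FullFock H) x = inner ℂ (f : FullFock H) y) : x = y := by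
  refine ext_inner_left ℂ fun z => ?_
  induction z using UniformSpace.Completion.induction_on with
  | hp => exact isClosed_eq (by fun_prop) (by fun_prop)
  | ih f => exact h f

theorem adjoint_leftCreation_vacuum (h : H) :
    ContinuousLinearMap.adjoint (leftCreation h) (vacuum H) = 0 := by
  refine eq_of_inner_coe fun f => ?_
  rw [ContinuousLinearMap.adjoint_inner_right, leftCreation_coe, inner_zero_right]
  exact (UniformSpace.Completion.inner_coe _ _).trans (inner_preVacuum_eq_zero rfl)

theorem adjoint_rightCreation_vacuum (h : H) :
    ContinuousLinearMap.adjoint (rightCreation h) (vacuum H) = 0 := by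
  refine eq_of_inner_coe fun f => ?_
  rw [ContinuousLinearMap.adjoint_inner_right, rightCreation_coe, inner_zero_right]
  exact (UniformSpace.Completion.inner_coe _ _).trans (inner_preVacuum_eq_zero rfl)

/-- Algebraic tensors are enough: they contain the vacuum and are invariant under the family, so all
moments are computed there. -/
theorem adjoint_leftCreation_fockEmbed (h h' : H) (η : TensorAlgebra ℂ H) :
    ContinuousLinearMap.adjoint (leftCreation h) (fockEmbed (TensorAlgebra.ι ℂ h' * η)) =
      inner ℂ h h' • fockEmbed η := by
  refine eq_of_inner_coe fun f => ?_
  rw [ContinuousLinearMap.adjoint_inner_right, leftCreation_coe, inner_smul_right, fockEmbed_apply,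
    fockEmbed_apply, UniformSpace.Completion.inner_coe, UniformSpace.Completion.inner_coe,
    preEmbed_ι_mul, inner_preLeft]

theorem adjoint_rightCreation_fockEmbed (h h' : H) (η : TensorAlgebra ℂ H) :
    ContinuousLinearMap.adjoint (rightCreation h) (fockEmbed (η * TensorAlgebra.ι ℂ h')) =
      inner ℂ h h' • fockEmbed η := by
  refine eq_of_inner_coe fun f => ?_
  rw [ContinuousLinearMap.adjoint_inner_right, rightCreation_coe, inner_smul_right,
    fockEmbed_apply, fockEmbed_apply, UniformSpace.Completion.inner_coe,
    UniformSpace.Completion.inner_coe, preEmbed_mul_ι, inner_preRight]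

theorem inner_vacuum_fockEmbed (η : TensorAlgebra ℂ H) :
    inner ℂ (vacuum H) (fockEmbed η) = vac H η := by
  have key : (innerSL ℂ (vacuum H)).toLinearMap ∘ₗ fockEmbed = vac H := by
    refine tensorAlgebra_ext_left ?_ fun b η => ?_
    · change inner ℂ (vacuum H) (fockEmbed 1) = _
      rw [fockEmbed_one, vac_one]
      exact (UniformSpace.Completion.inner_coe _ _).trans inner_preVacuum_self
    · change inner ℂ (vacuum H) (fockEmbed _) = _
      rw [fockEmbed_ι_mul, ← ContinuousLinearMap.adjoint_inner_left, adjoint_leftCreation_vacuum,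
        inner_zero_left, vac_mul, vac_ι, zero_mul]
  exact LinearMap.congr_fun key η

/-- The data of the operator `l(h) + l*(h)` or `r(h) + r*(h)`. -/
def fockData (h : H) : OpData H where
  create := h
  scalar := 0
  preserve := 0
  annihilate := (innerSL ℂ h).toLinearMap

theorem fockData_new (h : H) : (fockData h).new = TensorAlgebra.ι ℂ h := by
  simp [OpData.new, fockData]

theorem fockData_modify (h x : H) : (fockData h).modify x = algebraMap ℂ _ (inner ℂ h x) := by
  simp [OpData.modify, fockData]

theorem fockEmbed_left (h : H) (η : TensorAlgebra ℂ H) :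
    fockEmbed ((fockData h).left η) =
      (leftCreation h + ContinuousLinearMap.adjoint (leftCreation h)) (fockEmbed η) := by
  have key : fockEmbed ∘ₗ (fockData h).left =
      (leftCreation h + ContinuousLinearMap.adjoint (leftCreation h)).toLinearMap ∘ₗ
        fockEmbed := by
    refine tensorAlgebra_ext_left ?_ fun b η => ?_
    · change fockEmbed ((fockData h).left 1) = leftCreation h (fockEmbed 1) +
        ContinuousLinearMap.adjoint (leftCreation h) (fockEmbed 1)
      rw [OpData.left_one, fockData_new, ← fockEmbed_ι_mul, fockEmbed_one,
        adjoint_leftCreation_vacuum, mul_one, add_zero]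
    · change fockEmbed ((fockData h).left (TensorAlgebra.ι ℂ b * η)) =
        leftCreation h (fockEmbed (TensorAlgebra.ι ℂ b * η)) +
        ContinuousLinearMap.adjoint (leftCreation h) (fockEmbed (TensorAlgebra.ι ℂ b * η))
      rw [OpData.left_ι_mul, fockData_new, map_add, fockEmbed_ι_mul, fockData_modify,
        ← Algebra.smul_def, map_smul, adjoint_leftCreation_fockEmbed]
  exact LinearMap.congr_fun key η

theorem fockEmbed_right (h : H) (η : TensorAlgebra ℂ H) :
    fockEmbed ((fockData h).right η) =
      (rightCreation h + ContinuousLinearMap.adjoint (rightCreation h)) (fockEmbed η) := by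
  have key : fockEmbed ∘ₗ (fockData h).right =
      (rightCreation h + ContinuousLinearMap.adjoint (rightCreation h)).toLinearMap ∘ₗ
        fockEmbed := by
    refine tensorAlgebra_ext_right ?_ fun b η => ?_
    · change fockEmbed ((fockData h).right 1) = rightCreation h (fockEmbed 1) +
        ContinuousLinearMap.adjoint (rightCreation h) (fockEmbed 1)
      rw [OpData.right_one, fockData_new, ← fockEmbed_mul_ι, fockEmbed_one,
        adjoint_rightCreation_vacuum, one_mul, add_zero]
    · change fockEmbed ((fockData h).right (η * TensorAlgebra.ι ℂ b)) =
        rightCreation h (fockEmbed (η * TensorAlgebra.ι ℂ b)) +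
        ContinuousLinearMap.adjoint (rightCreation h) (fockEmbed (η * TensorAlgebra.ι ℂ b))
      rw [OpData.right_mul_ι, fockData_new, map_add, fockEmbed_mul_ι, fockData_modify,
        ← Algebra.commutes, ← Algebra.smul_def, map_smul, adjoint_rightCreation_fockEmbed]
  exact LinearMap.congr_fun key η

variable {I J : Type u}

theorem fockEmbed_faceOp (h : I ⊕ J → H) (k : I ⊕ J) (η : TensorAlgebra ℂ H) :
    fockEmbed (faceOp (fun k => fockData (h k)) k η) = fockFamily h k (fockEmbed η) := by
  cases k
  · exact fockEmbed_left _ η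
  · exact fockEmbed_right _ η

theorem distribution_fockFamily (h : I ⊕ J → H) :
    distribution (vacuumState H) (fockFamily h) = vacDist fun k => fockData (h k) := by
  have key : ∀ (P : FreeAlgebra ℂ (I ⊕ J)) (η : TensorAlgebra ℂ H),
      fockEmbed (FreeAlgebra.lift ℂ (faceOp fun k => fockData (h k)) P η) =
        FreeAlgebra.lift ℂ (fockFamily h) P (fockEmbed η) := by
    intro P
    induction P using FreeAlgebra.induction with
    | grade0 r => intro η; simp [Algebra.algebraMap_eq_smul_one]
    | grade1 k => intro η; simp [fockEmbed_faceOp]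
    | mul a b ha hb => intro η; simp [ha, hb]
    | add a b ha hb => intro η; simp [ha, hb]
  ext P
  change inner ℂ (vacuum H) (FreeAlgebra.lift ℂ (fockFamily h) P (vacuum H)) =
    vac H (FreeAlgebra.lift ℂ (faceOp fun k => fockData (h k)) P 1)
  rw [← inner_vacuum_fockEmbed, key, fockEmbed_one]

/-- The cumulants of the family `fockFamily h`. -/
def fockCumulant (h : I ⊕ J → H) : List (I ⊕ J) → ℂ
  | [k, l] => inner ℂ (h k) (h l)
  | _ => 0

/-- The data `fockData h`, on a space with an additional vector from which `h` is recovered. -/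
def extendedFockData (h : H) : OpData (H × ℂ) where
  create := (h, 0)
  scalar := 0
  preserve := (LinearMap.toSpanSingleton ℂ (H × ℂ) (h, 0)) ∘ₗ LinearMap.snd ℂ H ℂ
  annihilate := (innerSL ℂ h).toLinearMap ∘ₗ LinearMap.fst ℂ H ℂ

/-- The vector which represents an incomplete block. -/
def blockVector (h : I ⊕ J → H) : List (I ⊕ J) → H × ℂ
  | [] => (0, 1)
  | [k] => (h k, 0)
  | _ => 0

/-- Both models map to one on `H × ℂ`: `H` as the first summand, the letter `[k]` to `(h k, 0)`,
longer words to zero. The empty word is never created from the vacuum, but prolonging it gives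
`[k]`; the extra vector `(0, 1)` makes the map compatible there too. -/
theorem distribution_fockFamily_eq_cumDist (h : I ⊕ J → H) :
    distribution (vacuumState H) (fockFamily h) = cumDist (fockCumulant h) := by
  rw [distribution_fockFamily]
  refine (vacDist_compat (Δ := LinearMap.inl ℂ H ℂ) (e := fun k => extendedFockData (h k))
    fun k => ⟨rfl, rfl, fun x => ?_, fun x => rfl⟩).trans
    (vacDist_compat (Δ := Finsupp.linearCombination ℂ (blockVector h)) fun k =>
      ⟨?_, rfl, ?_, ?_⟩).symm
  · simp [fockData, extendedFockData]
  · simp [wordData, extendedFockData, blockVector]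
  · suffices Finsupp.linearCombination ℂ (blockVector h) ∘ₗ
        (wordData (fockCumulant h) k).preserve =
        (extendedFockData (h k)).preserve ∘ₗ Finsupp.linearCombination ℂ (blockVector h) from
      LinearMap.congr_fun this
    refine Finsupp.lhom_ext' fun b => ?_
    ext
    all_goals
      rcases b with _ | ⟨l, _ | ⟨m, b⟩⟩ <;>
      simp [wordData, extendedFockData, blockVector, Finsupp.lmapDomain_apply,
        Finsupp.mapDomain_single]
  · suffices (extendedFockData (h k)).annihilate ∘ₗ
        Finsupp.linearCombination ℂ (blockVector h) = (wordData (fockCumulant h) k).annihilate from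
      LinearMap.congr_fun this
    refine Finsupp.lhom_ext' fun b => ?_
    ext
    rcases b with _ | ⟨l, _ | ⟨m, b⟩⟩ <;>
      simp [wordData, extendedFockData, blockVector, fockCumulant]

theorem fockCumulant_eq_zero (h : I ⊕ J → H) {α : List (I ⊕ J)} (hα : α.length ≠ 2) :
    fockCumulant h α = 0 := by
  rcases α with _ | ⟨k, _ | ⟨l, _ | ⟨m, α⟩⟩⟩ <;> simp_all [fockCumulant]

theorem isBiFreeCentralLimit_fockFamily (h : I ⊕ J → H) :
    IsBiFreeCentralLimit (distribution (vacuumState H) (fockFamily h)) := by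
  rw [distribution_fockFamily_eq_cumDist]
  refine ⟨cumDist_one _, fun α hα => ?_⟩
  have hα' : α ≠ [] := by rintro rfl; simp at hα
  refine ⟨cumPoly α, isBiFreeCumulantPolynomial_cumPoly hα', ?_⟩
  rw [evalMoments_cumDist_cumPoly _ hα', fockCumulant_eq_zero h (by omega)]

theorem secondMoments_fockFamily (h : I ⊕ J → H) (k l : I ⊕ J) :
    secondMoments (distribution (vacuumState H) (fockFamily h)) k l = inner ℂ (h k) (h l) := by
  rw [distribution_fockFamily]
  have h1 : vac H (faceOp (fun k => fockData (h k)) k (TensorAlgebra.ι ℂ (h l))) =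
      inner ℂ (h k) (h l) := by
    rcases k with i | j
    · change vac H ((fockData (h (Sum.inl i))).left _) = _
      rw [← mul_one (TensorAlgebra.ι ℂ (h l)), OpData.left_ι_mul]
      simp [fockData_modify, vac_mul, vac_ι, vac_algebraMap]
    · change vac H ((fockData (h (Sum.inr j))).right _) = _
      rw [← one_mul (TensorAlgebra.ι ℂ (h l)), OpData.right_mul_ι]
      simp [fockData_modify, vac_mul, vac_ι, vac_algebraMap]
  simpa [secondMoments, vacDist, distribution, vecState_apply, faceOp_one, fockData_new] using h1

end Fock

/-! ### Positivity -/

section Adjoint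

variable {κ : Type u}

theorem adj_add (P Q : FreeAlgebra ℂ κ) : adj (P + Q) = adj P + adj Q := by
  rw [adj, map_add, MonoidAlgebra.coeff_add]
  exact Finsupp.sum_add_index' (by simp) (by simp [add_smul])

theorem adj_zero : adj (0 : FreeAlgebra ℂ κ) = 0 := by simp [adj]

theorem adj_smul (c : ℂ) (P : FreeAlgebra ℂ κ) : adj (c • P) = (starRingEnd ℂ c) • adj P := by
  rw [adj, map_smul, MonoidAlgebra.coeff_smul, Finsupp.sum_smul_index (by simp), adj,
    Finsupp.smul_sum]
  simp [mul_smul]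

theorem adj_monomial (l : List κ) : adj (monomial l) = monomial l.reverse := by
  have h : FreeAlgebra.equivMonoidAlgebraFreeMonoid (R := ℂ) (monomial l) =
      MonoidAlgebra.single (FreeMonoid.ofList l) 1 := by
    induction l with
    | nil => simp [monomial_nil, MonoidAlgebra.one_def]
    | cons k l ih =>
      rw [monomial_cons, map_mul, ih]
      simp [FreeAlgebra.equivMonoidAlgebraFreeMonoid, MonoidAlgebra.single_mul_single,
        FreeMonoid.ofList_cons]
  simp [adj, h]

theorem adj_ι (k : κ) : adj (FreeAlgebra.ι ℂ k) = FreeAlgebra.ι ℂ k := by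
  simpa [monomial] using adj_monomial [k]

theorem lift_adj {A : Type v} [Ring A] [StarRing A] [Algebra ℂ A] [StarModule ℂ A] {z : κ → A}
    (hz : ∀ k, IsSelfAdjoint (z k)) (P : FreeAlgebra ℂ κ) :
    FreeAlgebra.lift ℂ z (adj P) = star (FreeAlgebra.lift ℂ z P) := by
  have hP : P ∈ Submodule.span ℂ (Set.range (monomial (κ := κ))) := by
    rw [span_monomial]; trivial
  induction hP using Submodule.span_induction with
  | mem x hx =>
    obtain ⟨l, rfl⟩ := hx
    rw [adj_monomial]
    induction l with
    | nil => simp [monomial_nil]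
    | cons k l ih =>
      rw [List.reverse_cons, monomial_append, map_mul, ih, monomial_cons k l, map_mul, star_mul,
        monomial_cons k, monomial_nil, mul_one, FreeAlgebra.lift_ι_apply, (hz k).star_eq]
  | zero => simp [adj_zero]
  | add x y _ _ hx hy => simp [adj_add, hx, hy]
  | smul c x _ hx => simp [adj_smul, hx]

theorem adj_finsuppSum (x : κ →₀ ℂ) :
    adj (x.sum fun k c => c • FreeAlgebra.ι ℂ k) =
      x.sum fun k c => (starRingEnd ℂ c) • FreeAlgebra.ι ℂ k := by
  refine (map_finsuppSum (AddMonoidHom.mk' adj adj_add) x _).trans ?_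
  simp [adj_smul, adj_ι]

/-- On linear polynomials positivity of the functional is positivity of the quadratic form of second
moments. -/
theorem map_adj_finsuppSum_mul (φ : FreeAlgebra ℂ κ →ₗ[ℂ] ℂ) (x : κ →₀ ℂ) :
    φ (adj (x.sum fun k c => c • FreeAlgebra.ι ℂ k) * x.sum fun k c => c • FreeAlgebra.ι ℂ k) =
      x.sum fun k c => x.sum fun l d => star c * secondMoments φ k l * d := by
  rw [adj_finsuppSum]
  simp only [Finsupp.sum, Finset.sum_mul_sum, map_sum]
  refine Finset.sum_congr rfl fun k _ => Finset.sum_congr rfl fun l _ => ?_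
  simp [secondMoments]
  ring

/-- The second moments of a positive functional form a positive semidefinite matrix. -/
theorem posSemidef_secondMoments {φ : FreeAlgebra ℂ κ →ₗ[ℂ] ℂ} (h : ∀ P, 0 ≤ φ (adj P * P)) :
    (secondMoments φ).PosSemidef := by
  refine ⟨?_, fun x => (map_adj_finsuppSum_mul φ x).symm ▸ h _⟩
  have him : ∀ P, (φ (adj P * P)).im = 0 := fun P => ((Complex.le_def.1 (h P)).2).symm
  have hdiag : ∀ k, (φ (FreeAlgebra.ι ℂ k * FreeAlgebra.ι ℂ k)).im = 0 := fun k => by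
    simpa [adj_ι] using him (FreeAlgebra.ι ℂ k)
  ext k l
  -- Polarisation: reality of the values at `X_k + X_l` and `X_k + i X_l` yields hermitian symmetry.
  have h1 := him (FreeAlgebra.ι ℂ k + FreeAlgebra.ι ℂ l)
  have h2 := him (FreeAlgebra.ι ℂ k + Complex.I • FreeAlgebra.ι ℂ l)
  simp only [adj_add, adj_smul, adj_ι, add_mul, mul_add, map_add, smul_mul_assoc, mul_smul_comm,
    map_smul, smul_eq_mul, Complex.add_im, Complex.mul_im, Complex.mul_re, Complex.conj_I,
    Complex.neg_re, Complex.neg_im, Complex.I_re, Complex.I_im, hdiag] at h1 h2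
  simp only [secondMoments, Matrix.conjTranspose_apply, Matrix.of_apply]
  apply Complex.ext
  · simp only [RCLike.star_def, Complex.conj_re]; linarith
  · simp only [RCLike.star_def, Complex.conj_im]; linarith

end Adjoint

/-! ### Gram vectors of a positive semidefinite matrix -/

section Gram

variable {κ : Type u}

/-- The sesquilinear form on `κ →₀ ℂ` given by a positive semidefinite matrix. -/
@[reducible]
def gramCore {C : Matrix κ κ ℂ} (hC : C.PosSemidef) : PreInnerProductSpace.Core ℂ (κ →₀ ℂ) where
  inner f g := f.sum fun k c => g.sum fun l d => star c * C k l * d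
  conj_inner_symm f g := by
    rw [Finsupp.sum_comm]
    simp only [map_finsuppSum]
    refine Finsupp.sum_congr fun k _ => Finsupp.sum_congr fun l _ => ?_
    rw [← hC.1.apply k l]
    simp [mul_comm, mul_left_comm]
  re_inner_nonneg f := (Complex.le_def.1 (hC.2 f)).1
  add_left f g h := by
    refine Finsupp.sum_add_index' (by simp) fun k c d => ?_
    simp [← Finsupp.sum_add, add_mul]
  smul_left f g c := by
    rw [Finsupp.sum_smul_index (by simp), Finsupp.mul_sum]
    simp [Finsupp.mul_sum, mul_assoc]

/-- A positive semidefinite matrix is a Gram matrix. -/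
theorem exists_gram {C : Matrix κ κ ℂ} (hC : C.PosSemidef) :
    ∃ (H : Type u) (_ : NormedAddCommGroup H) (_ : InnerProductSpace ℂ H) (h : κ → H),
      ∀ k l, C k l = inner ℂ (h k) (h l) := by
  -- The form may have null vectors; passing to the completion also separates them.
  let : SeminormedAddCommGroup (κ →₀ ℂ) :=
    @InnerProductSpace.Core.toSeminormedAddCommGroup ℂ _ _ _ _ (gramCore hC)
  let : InnerProductSpace ℂ (κ →₀ ℂ) := InnerProductSpace.ofCore (gramCore hC)
  refine ⟨UniformSpace.Completion (κ →₀ ℂ), inferInstance, inferInstance,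
    fun k => ((Finsupp.single k 1 : κ →₀ ℂ) : UniformSpace.Completion (κ →₀ ℂ)), fun k l => ?_⟩
  rw [UniformSpace.Completion.inner_coe]
  change _ = (Finsupp.single k (1 : ℂ)).sum fun k c =>
    (Finsupp.single l (1 : ℂ)).sum fun l d => star c * C k l * d
  simp

end Gram

/-! ### Positivity of the Fock family and uniqueness -/

section Main

variable {I J : Type u}

theorem isSelfAdjoint_fockFamily {H : Type w} [NormedAddCommGroup H] [InnerProductSpace ℂ H]
    (h : I ⊕ J → H) (k : I ⊕ J) : IsSelfAdjoint (fockFamily h k) := by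
  cases k
  · exact IsSelfAdjoint.add_star_self _
  · exact IsSelfAdjoint.add_star_self _

theorem isHermitian_fockFamily {H : Type w} [NormedAddCommGroup H] [InnerProductSpace ℂ H]
    (h : I ⊕ J → H) :
    IsHermitianBiFreeCentralLimit (distribution (vacuumState H) (fockFamily h)) where
  toIsBiFreeCentralLimit := isBiFreeCentralLimit_fockFamily h
  nonneg P := by
    change 0 ≤ inner ℂ (vacuum H) (FreeAlgebra.lift ℂ (fockFamily h) (adj P * P) (vacuum H))
    rw [map_mul, lift_adj (isSelfAdjoint_fockFamily h), ContinuousLinearMap.star_eq_adjoint,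
      mul_apply_eq_comp, ContinuousLinearMap.adjoint_inner_right]
    rw [inner_self_eq_norm_sq_to_K]
    rw [← RCLike.ofReal_pow]
    exact RCLike.ofReal_nonneg.2 (sq_nonneg _)

/-- A bi-free central limit distribution is determined by its second moments. -/
theorem IsBiFreeCentralLimit.ext {φ φ' : FreeAlgebra ℂ (I ⊕ J) →ₗ[ℂ] ℂ}
    (hφ : IsBiFreeCentralLimit φ) (hφ' : IsBiFreeCentralLimit φ')
    (h : secondMoments φ = secondMoments φ') : φ = φ' := by
  refine functional_ext fun α => ?_
  induction hn : α.length using Nat.strong_induction_on generalizing α with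
  | _ n ih =>
  subst hn
  by_cases hα : α.length = 1 ∨ 3 ≤ α.length
  · have hα' : α ≠ [] := by rintro rfl; simp at hα
    -- A vanishing cumulant expresses the moment of `α` by moments of shorter words. The polynomial
    -- `R` depends on `μ`, hence its replacement by `cumPoly α`.
    have hz : ∀ {μ : FreeAlgebra ℂ (I ⊕ J) →ₗ[ℂ] ℂ}, IsBiFreeCentralLimit μ →
        μ (monomial α) = -evalMoments μ (cumPoly α - MvPolynomial.X α) := fun {μ} hμ => by
      obtain ⟨R, hR, h0⟩ := hμ.cumulant α hα
      rw [hR.evalMoments_eq hα' hμ.map_one] at h0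
      simp only [evalMoments, map_sub, MvPolynomial.eval_X] at h0 ⊢
      rw [h0]; ring
    rw [hz hφ, hz hφ', evalMoments, evalMoments]
    exact congrArg _ (eval_congr_vars fun v hv => ih _ (cumPoly_vars hα' v hv).2.1 v rfl)
  · rcases α with _ | ⟨k, _ | ⟨l, _ | ⟨m, α⟩⟩⟩
    · rw [monomial_nil, hφ.map_one, hφ'.map_one]
    · simp at hα
    · simpa [monomial, secondMoments] using congrFun (congrFun h k) l
    · simp at hα

end Main

end BiFree
end
theorem theorem7p8 {I J : Type u} :
    (∀ φ : FreeAlgebra ℂ (I ⊕ J) →ₗ[ℂ] ℂ, BiFree.IsBiFreeCentralLimit φ →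
      (BiFree.IsHermitianBiFreeCentralLimit φ ↔ (BiFree.secondMoments φ).PosSemidef)) ∧
    (Finite (I ⊕ J) →
      ∀ (H : Type w) [NormedAddCommGroup H] [InnerProductSpace ℂ H] [CompleteSpace H]
        (h : I ⊕ J → H) (C : Matrix (I ⊕ J) (I ⊕ J) ℂ), (∀ k l, C k l = inner ℂ (h k) (h l)) →
        (∀ k, IsSelfAdjoint (BiFree.fockFamily h k)) ∧
        BiFree.IsHermitianBiFreeCentralLimit
          (BiFree.distribution (BiFree.vacuumState H) (BiFree.fockFamily h)) ∧
        BiFree.secondMoments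
          (BiFree.distribution (BiFree.vacuumState H) (BiFree.fockFamily h)) = C ∧
        ∀ φ : FreeAlgebra ℂ (I ⊕ J) →ₗ[ℂ] ℂ, BiFree.IsBiFreeCentralLimit φ →
          BiFree.secondMoments φ = C →
          φ = BiFree.distribution (BiFree.vacuumState H) (BiFree.fockFamily h)) := by
  refine ⟨fun φ hφ => ⟨fun h => BiFree.posSemidef_secondMoments h.nonneg, fun hC => ?_⟩, ?_⟩
  · obtain ⟨H, _, _, h, hh⟩ := BiFree.exists_gram hC
    have hm : BiFree.secondMoments φ = BiFree.secondMoments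
        (BiFree.distribution (BiFree.vacuumState H) (BiFree.fockFamily h)) := by
      ext k l
      rw [hh, BiFree.secondMoments_fockFamily]
    -- Uniqueness transports positivity from the Fock family to `φ`.
    rw [hφ.ext (BiFree.isBiFreeCentralLimit_fockFamily h) hm]
    exact BiFree.isHermitian_fockFamily h
  · intro _ H _ _ _ h C hC
    have hm : BiFree.secondMoments
        (BiFree.distribution (BiFree.vacuumState H) (BiFree.fockFamily h)) = C := by
      ext k l
      rw [hC, BiFree.secondMoments_fockFamily]
    exact ⟨BiFree.isSelfAdjoint_fockFamily h, BiFree.isHermitian_fockFamily h, hm,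
      fun φ hφ h' => hφ.ext (BiFree.isBiFreeCentralLimit_fockFamily h) (h'.trans hm.symm)⟩
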